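/- Let $(\Omega,\mathcal F,\mathbb P)$ be a probability space, $(S,\mathcal S)$ a measurable space, $2\le i\le r$ integers, $(X_k)_{k\ge1}$ an i.i.d. sequence of $S$-valued random variables, and $h\colon S^r\to\mathbb R$ a measurable function (for the product $\sigma$-algebra on $S^r$) that is symmetric, i.e. $h(x_{\sigma(1)},\dots,x_{\sigma(r)})=h(x_1,\dots,x_r)$ for all $x_1,\dots,x_r\in S$ and all permutations $\sigma$ of $\{1,\dots,r\}$. Put $$U_n:=\sum_{1\le i_1<\dots<i_r\le n}h(X_{i_1},\dots,X_{i_r}).$$ Suppose that $h$ is degenerate of order $i-1$: the random variable $Y:=h(X_1,\dots,X_r)$ is integrable, $\mathbb E[Y\mid X_1,\dots,X_{i-1}]=0$ almost surely, and $\mathbb E[Y\mid X_1,\dots,X_i]$ is not almost surely equal to $0$. Let $\alpha\in(r-i/2,\,r)$ and let $\gamma>0$ be such that $\mathbb E\big[\exp\big(R\,|h(X_1,\dots,X_r)|^{\gamma}\big)\big]<\infty$ for every $R>0$. Then for every $\varepsilon>0$ $$\sum_{N\ge1}\exp\Big(2^{N\left(\alpha-(r-i/2)\right)\frac{2\gamma}{i\gamma+2}}\Big)\,\mathbb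 P\Big\{\max_{r\le n\le 2^N}|U_n|>\varepsilon\,2^{N\alpha}\Big\}<+\infty,$$ where a maximum over an empty set of indices is $0$. -/

import Mathlib

open MeasureTheory ProbabilityTheory

noncomputable section

namespace UStat

/-- `IsIID X P`: the `X k` are measurable, independent and identically distributed under `P`.
Sequences are indexed from `0`, so `X k` is the variable usually written `X_{k+1}`. -/
structure IsIID {Ω S : Type*} [MeasurableSpace Ω] [MeasurableSpace S]
    (X : ℕ → Ω → S) (P : Measure Ω) : Prop where
  measurable : ∀ k, Measurable (X k)
  indep : iIndepFun X P
  identDistrib : ∀ k, IdentDistrib (X k) (X 0) P P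

/-- A kernel of `r` variables is symmetric if it is invariant under all permutations of them. -/
def IsSymmetric {S : Type*} {r : ℕ} (h : (Fin r → S) → ℝ) : Prop :=
  ∀ (σ : Equiv.Perm (Fin r)) (x : Fin r → S), h (fun j => x (σ j)) = h x

/-- The random variable `h (X_1, …, X_r)`. -/
def kernelVar {Ω S : Type*} {r : ℕ} (h : (Fin r → S) → ℝ) (X : ℕ → Ω → S) (ω : Ω) : ℝ :=
  h (fun j => X (j : ℕ) ω)

open Classical in
/-- The index set of strictly increasing `r`-tuples of elements of `{0, …, n - 1}`. -/
def indexSet (r n : ℕ) : Finset (Fin r → ℕ) :=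
  (Fintype.piFinset fun _ : Fin r => Finset.range n).filter StrictMono

/-- The (unnormalized) `U`-statistic: the sum of `h (X_{i_1}, …, X_{i_r})` over all strictly
increasing `r`-tuples of indices among the first `n` ones. -/
def uStat {Ω S : Type*} {r : ℕ} (h : (Fin r → S) → ℝ) (X : ℕ → Ω → S) (n : ℕ) (ω : Ω) : ℝ :=
  ∑ i ∈ indexSet r n, h (fun j => X (i j) ω)

/-- The maximum of `|U_n|` over `r ≤ n ≤ M` (equal to `0` if there is no such `n`). -/
def maxAbsUStat {Ω S : Type*} {r : ℕ} (h : (Fin r → S) → ℝ) (X : ℕ → Ω → S) (M : ℕ) (ω : Ω) : ℝ :=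
  ((Finset.Icc r M).sup fun n => ‖uStat h X n ω‖₊ : NNReal)

/-- The σ-algebra generated by the first `d` random variables of the sequence. -/
abbrev sigmaFirst {Ω S : Type*} [MeasurableSpace S] (X : ℕ → Ω → S) (d : ℕ) : MeasurableSpace Ω :=
  ⨆ k : Fin d, MeasurableSpace.comap (X (k : ℕ)) inferInstance

/-- `h` is degenerate of order `d`: `Y = h (X_1, …, X_r)` is integrable, the conditional
expectation of `Y` given the first `d` variables vanishes almost surely, and the one given the
first `d + 1` variables does not. -/
structure IsDegenerate {Ω S : Type*} [MeasurableSpace Ω] [MeasurableSpace S] {r : ℕ}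
    (h : (Fin r → S) → ℝ) (X : ℕ → Ω → S) (P : Measure Ω) (d : ℕ) : Prop where
  integrable : Integrable (kernelVar h X) P
  condExp_eq_zero : P[kernelVar h X | sigmaFirst X d] =ᵐ[P] 0
  condExp_succ_ne_zero : ¬ P[kernelVar h X | sigmaFirst X (d + 1)] =ᵐ[P] 0

end UStat

end

/-! Put V = 2^N, δ = α - (r - i/2) and κ = 2δγ/(iγ + 2). Each P(|U_n| > ε V^α) with n ≤ V is at most
a power of V times exp(-2 V^κ). A union bound over n then costs only a factor V, so no maximal
inequality is needed: one factor exp(-V^κ) cancels the weight and the other makes the series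
converge.

For fixed n, truncate h at L = η V^a with aγ = κ. Truncation destroys degeneracy, so the truncated
kernel is expanded into Hoeffding components, each centered in its own coordinates. Components with
fewer than i coordinates would vanish for h itself; for the truncation their L¹ norm is at most a
constant times E|h - trunc h| (`integral_abs_marginal_le`), which the exponential moments bound by a
multiple of exp(-2 V^κ) (`exists_integral_abs_sub_trunc_le`). Markov's inequality disposes of them
and of the truncation error.

Components with at least i coordinates are bounded, and `integral_tupleSum_pow_le` controls their
moments of order 2q: with the largest index as time, the sum is a martingale when the kernel is
centered in its last coordinate, and one inducts on the number of coordinates. Markov's inequality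
gives the q-th power of a base of order q^i V^(2r-i) L² / V^(2α). For q ≈ 2 V^κ the choice of κ and
a keeps this base bounded, and a small η makes it at most 1/e. -/

namespace UStat

/-- The law of a family of independent variables indexed by `ι`, all distributed as `μ`. -/
noncomputable abbrev iidLaw (ι : Type*) {S : Type*} [MeasurableSpace S] (μ : Measure S)
    [IsProbabilityMeasure μ] : Measure (ι → S) :=
  Measure.infinitePi fun _ : ι => μ

/-! ### Resampling and selecting coordinates of an i.i.d. family -/

section Law

variable {ι S : Type*} [MeasurableSpace S] (μ : Measure S) [IsProbabilityMeasure μ]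

theorem measurable_piecewise_prod [DecidableEq ι] (B : Finset ι) :
    Measurable (fun p : (ι → S) × (ι → S) => B.piecewise p.1 p.2) := by
  refine measurable_pi_iff.2 fun j => ?_
  by_cases hj : j ∈ B
  · simp only [Finset.piecewise, hj, if_true]; fun_prop
  · simp only [Finset.piecewise, hj, if_false]; fun_prop

/-- Resampling the coordinates outside of `B` preserves the law of an i.i.d. family. -/
theorem map_piecewise_iidLaw [DecidableEq ι] (B : Finset ι) :
    ((iidLaw ι μ).prod (iidLaw ι μ)).map (fun p => B.piecewise p.1 p.2) = iidLaw ι μ := by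
  have hm := measurable_piecewise_prod (S := S) B
  refine Measure.eq_infinitePi _ fun s t ht => ?_
  rw [Measure.map_apply hm (.pi s.countable_toSet fun _ _ => ht _)]
  have : (fun p : (ι → S) × (ι → S) => B.piecewise p.1 p.2) ⁻¹' (Set.pi s t) =
      (Set.pi (s.filter (· ∈ B) : Finset ι) t) ×ˢ (Set.pi (s.filter (· ∉ B) : Finset ι) t) := by
    ext p
    simp only [Set.mem_preimage, Set.mem_pi, Finset.mem_coe, Set.mem_prod, Finset.mem_filter,
      Finset.piecewise]
    constructor
    · intro H
      exact ⟨fun j hj => by simpa [hj.2] using H j hj.1, fun j hj => by simpa [hj.2] using H j hj.1⟩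
    · rintro ⟨H1, H2⟩ j hj
      by_cases hB : j ∈ B
      · simpa [hB] using H1 j ⟨hj, hB⟩
      · simpa [hB] using H2 j ⟨hj, hB⟩
  rw [this, Measure.prod_prod, Measure.infinitePi_pi _ fun i _ => ht i,
    Measure.infinitePi_pi _ fun i _ => ht i, Finset.prod_filter_mul_prod_filter_not]

/-- Resampling one coordinate preserves the law of an i.i.d. family. -/
theorem map_update_iidLaw [DecidableEq ι] (m : ι) :
    ((iidLaw ι μ).prod μ).map (fun p => Function.update p.1 m p.2) = iidLaw ι μ := by
  have hm : Measurable (fun p : (ι → S) × S => Function.update p.1 m p.2) := by fun_prop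
  refine Measure.eq_infinitePi _ fun s t ht => ?_
  rw [Measure.map_apply hm (.pi s.countable_toSet fun _ _ => ht _)]
  by_cases hms : m ∈ s
  · have : (fun p : (ι → S) × S => Function.update p.1 m p.2) ⁻¹' (Set.pi s t) =
        (Set.pi (s.erase m : Finset ι) t) ×ˢ (t m) := by
      ext p
      simp only [Set.mem_preimage, Set.mem_pi, Finset.mem_coe, Set.mem_prod, Finset.mem_erase]
      constructor
      · intro H
        exact ⟨fun j hj => by simpa [hj.1] using H j hj.2, by simpa using H m hms⟩
      · rintro ⟨H1, H2⟩ j hj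
        by_cases hB : j = m
        · subst hB; simpa using H2
        · simpa [hB] using H1 j ⟨hB, hj⟩
    rw [this, Measure.prod_prod, Measure.infinitePi_pi _ fun i _ => ht i,
      Finset.prod_erase_mul _ _ hms]
  · have : (fun p : (ι → S) × S => Function.update p.1 m p.2) ⁻¹' (Set.pi s t) =
        (Set.pi s t) ×ˢ Set.univ := by
      ext p
      simp only [Set.mem_preimage, Set.mem_pi, Finset.mem_coe, Set.mem_prod, Set.mem_univ,
        and_true]
      refine forall₂_congr fun j hj => ?_
      have : j ≠ m := fun e => hms (e ▸ hj)
      simp [this]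
    rw [this, Measure.prod_prod, Measure.infinitePi_pi _ fun i _ => ht i, measure_univ, mul_one]

theorem integral_iidLaw_update [DecidableEq ι] {G : (ι → S) → ℝ} (m : ι)
    (hG : Integrable G (iidLaw ι μ)) :
    ∫ z, G z ∂(iidLaw ι μ) = ∫ z, ∫ x, G (Function.update z m x) ∂μ ∂(iidLaw ι μ) := by
  have hm : Measurable (fun p : (ι → S) × S => Function.update p.1 m p.2) := by fun_prop
  have hG' : Integrable G (((iidLaw ι μ).prod μ).map (fun p => Function.update p.1 m p.2)) := by
    rwa [map_update_iidLaw]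
  rw [← integral_prod (fun p : (ι → S) × S => G (Function.update p.1 m p.2))
    (hG'.comp_measurable hm)]
  rw [← integral_map hm.aemeasurable hG'.aestronglyMeasurable, map_update_iidLaw]

theorem integral_iidLaw_piecewise [DecidableEq ι] {G : (ι → S) → ℝ} (B : Finset ι)
    (hG : Integrable G (iidLaw ι μ)) :
    ∫ z, G z ∂(iidLaw ι μ) = ∫ x, ∫ z, G (B.piecewise x z) ∂(iidLaw ι μ) ∂(iidLaw ι μ) := by
  have hm := measurable_piecewise_prod (S := S) B
  have hG' : Integrable G (((iidLaw ι μ).prod (iidLaw ι μ)).map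
      (fun p => B.piecewise p.1 p.2)) := by
    rwa [map_piecewise_iidLaw]
  rw [← integral_prod (fun p : (ι → S) × (ι → S) => G (B.piecewise p.1 p.2))
    (hG'.comp_measurable hm)]
  rw [← integral_map hm.aemeasurable hG'.aestronglyMeasurable, map_piecewise_iidLaw]

/-- Selecting coordinates along an injective map gives an i.i.d. family again. -/
theorem integral_comp_iidLaw {κ : Type*} {e : κ → ι} (he : Function.Injective e)
    {G : (κ → S) → ℝ} (hG : AEStronglyMeasurable G (iidLaw κ μ)) :
    ∫ z, G (fun j => z (e j)) ∂(iidLaw ι μ) = ∫ x, G x ∂(iidLaw κ μ) := by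
  have h : (iidLaw ι μ).map (fun z j => z (e j)) = iidLaw κ μ :=
    Measure.map_infinitePi_infinitePi_of_inj he
  rw [← h, integral_map
    (measurable_pi_lambda _ fun j => measurable_pi_apply (e j)).aemeasurable (by rwa [h])]

theorem integrable_comp_iidLaw {κ : Type*} {e : κ → ι} (he : Function.Injective e)
    {G : (κ → S) → ℝ} (hG : Integrable G (iidLaw κ μ)) :
    Integrable (fun z => G (fun j => z (e j))) (iidLaw ι μ) := by
  have h : (iidLaw ι μ).map (fun z j => z (e j)) = iidLaw κ μ :=
    Measure.map_infinitePi_infinitePi_of_inj he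
  rw [← h] at hG
  exact hG.comp_measurable (measurable_pi_lambda _ fun j => measurable_pi_apply (e j))

end Law

/-! ### Even moments of a sum of two variables -/

/-- The pointwise inequality behind the moment bound for martingales. -/
theorem add_pow_sub_le (s d : ℝ) {q : ℕ} (hq : 1 ≤ q) :
    (s + d) ^ (2 * q) - 2 * q * s ^ (2 * q - 1) * d ≤ (s ^ 2 + 9 * q * d ^ 2) ^ q := by
  obtain ⟨n, rfl⟩ : ∃ n, q = n + 1 := ⟨q - 1, by omega⟩
  have bern : ∀ a b : ℝ, 0 ≤ a → 0 ≤ b → a ^ (n + 1) + (n + 1) * a ^ n * b ≤ (a + b) ^ (n + 1) := by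
    intro a b ha hb
    have := pow_add_mul_le_add_pow_of_sq_nonneg ha (sq_nonneg b) (sq_nonneg (a + b))
      (by positivity) (n + 1)
    simpa using this
  have hq1 : (1 : ℝ) ≤ ((n + 1 : ℕ) : ℝ) := by exact_mod_cast hq
  have e1 : 2 * (n + 1) - 1 = 2 * n + 1 := by omega
  rw [e1]
  push_cast at *
  -- With q = n + 1 and x = d / s: if 2q|x| ≤ 1, then (1 + x)^(2q) ≤ exp(2qx) ≤ 1 + 2qx + 4q²x², the
  -- linear term is the one subtracted, and Bernoulli's inequality recovers a q-th power.
  by_cases hsmall : 2 * ((n : ℝ) + 1) * |d| ≤ |s|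
  · rcases eq_or_ne s 0 with rfl | hs
    · have : d = 0 := by
        have h0 : 0 ≤ |d| := abs_nonneg d
        simp only [abs_zero] at hsmall
        exact abs_eq_zero.1 (by nlinarith)
      subst this; simp
    set x := d / s with hx
    have hd : d = s * x := by rw [hx]; field_simp
    have hxs : 2 * ((n : ℝ) + 1) * |x| ≤ 1 := by
      rw [hx, abs_div, ← mul_div_assoc]
      exact (div_le_one (abs_pos.2 hs)).2 hsmall
    have hx1 : |2 * ((n : ℝ) + 1) * x| ≤ 1 := by
      rwa [abs_mul, abs_of_nonneg (by positivity : (0:ℝ) ≤ 2 * ((n : ℝ) + 1))]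
    have hxa : |x| ≤ 1 := by nlinarith [abs_nonneg x]
    have h1 : (1 + x) ^ (2 * (n + 1)) ≤ Real.exp (2 * ((n : ℝ) + 1) * x) := by
      have : Real.exp (2 * ((n : ℝ) + 1) * x) = Real.exp x ^ (2 * (n + 1)) := by
        rw [← Real.exp_nat_mul]; push_cast; ring_nf
      rw [this]
      refine pow_le_pow_left₀ ?_ (by linarith [Real.add_one_le_exp x]) _
      linarith [neg_abs_le x]
    have h2 := (abs_le.1 (Real.abs_exp_sub_one_sub_id_le hx1)).2
    have h3 := bern 1 (9 * ((n : ℝ) + 1) * x ^ 2) zero_le_one (by positivity)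
    simp only [one_pow, mul_one] at h3
    have h4 : (1 + x) ^ (2 * (n + 1)) - 2 * (n + 1) * x ≤
        (1 + 9 * ((n : ℝ) + 1) * x ^ 2) ^ (n + 1) := by
      nlinarith [sq_nonneg (((n : ℝ) + 1) * x)]
    have h5 := mul_le_mul_of_nonneg_left h4 (by positivity : 0 ≤ (s ^ 2) ^ (n + 1))
    have h6 : (s + d) ^ (2 * (n + 1)) - 2 * (n + 1) * s ^ (2 * n + 1) * d =
        (s ^ 2) ^ (n + 1) * ((1 + x) ^ (2 * (n + 1)) - 2 * (n + 1) * x) := by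
      rw [hd, show s + s * x = s * (1 + x) by ring, mul_pow, ← pow_mul]; ring
    have h7 : (s ^ 2 + 9 * ((n : ℝ) + 1) * d ^ 2) ^ (n + 1) =
        (s ^ 2) ^ (n + 1) * (1 + 9 * ((n : ℝ) + 1) * x ^ 2) ^ (n + 1) := by
      rw [← mul_pow, hd]; ring
    rw [h6, h7]; exact h5
  · push Not at hsmall
    have h0 : |s| * |d| ≤ 2 * ((n : ℝ) + 1) * d ^ 2 := by
      rw [← sq_abs d]; nlinarith [abs_nonneg d]
    -- Here |s d| ≤ 2q d². The square (s + d)² costs (4q + 1) d² and the subtracted term, through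
    -- Bernoulli, another 4q d²; the total 8q + 1 ≤ 9q explains the constant 9.
    set a := s ^ 2 + (4 * ((n : ℝ) + 1) + 1) * d ^ 2 with ha
    have ha0 : 0 ≤ a := by positivity
    have hsa : s ^ 2 ≤ a := by
      rw [ha]
      nlinarith [sq_nonneg d, mul_nonneg (by positivity : 0 ≤ (4 * ((n : ℝ) + 1) + 1)) (sq_nonneg d)]
    have h1 : (s + d) ^ (2 * (n + 1)) ≤ a ^ (n + 1) := by
      rw [pow_mul]
      refine pow_le_pow_left₀ (by positivity) ?_ _
      have : s * d ≤ |s| * |d| := by rw [← abs_mul]; exact le_abs_self _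
      rw [ha]; nlinarith
    have h2 : - (2 * ((n : ℝ) + 1) * s ^ (2 * n + 1) * d) ≤
        ((n : ℝ) + 1) * a ^ n * (4 * ((n : ℝ) + 1) * d ^ 2) := by
      have h3 : - (s * d) ≤ 2 * ((n : ℝ) + 1) * d ^ 2 := by
        refine le_trans ?_ h0
        rw [← abs_mul]; exact neg_le_abs _
      have h4 : (s ^ 2) ^ n ≤ a ^ n := pow_le_pow_left₀ (by positivity) hsa _
      calc _ = 2 * ((n : ℝ) + 1) * (s ^ 2) ^ n * (-(s * d)) := by rw [← pow_mul]; ring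
        _ ≤ 2 * ((n : ℝ) + 1) * (s ^ 2) ^ n * (2 * ((n : ℝ) + 1) * d ^ 2) := by gcongr
        _ ≤ 2 * ((n : ℝ) + 1) * a ^ n * (2 * ((n : ℝ) + 1) * d ^ 2) := by gcongr
        _ = _ := by ring
    have h5 := bern a (4 * ((n : ℝ) + 1) * d ^ 2) ha0 (by positivity)
    have h6 : (a + 4 * ((n : ℝ) + 1) * d ^ 2) ^ (n + 1) ≤
        (s ^ 2 + 9 * ((n : ℝ) + 1) * d ^ 2) ^ (n + 1) := by
      refine pow_le_pow_left₀ (by positivity) ?_ _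
      rw [ha]; nlinarith [mul_nonneg (Nat.cast_nonneg (α := ℝ) n) (sq_nonneg d)]
    linarith

section Moments

variable {Ω : Type*} [MeasurableSpace Ω] {P : Measure Ω}

/-- Minkowski's inequality in power form: (U + V)/(a + b) is a convex combination of U/a and V/b,
and x ↦ x^q is convex on the half-line. -/
theorem integral_add_pow_le {U V : Ω → ℝ} {a b : ℝ} (ha : 0 < a) (hb : 0 < b) {q : ℕ}
    (hU0 : ∀ ω, 0 ≤ U ω) (hV0 : ∀ ω, 0 ≤ V ω)
    (hUi : Integrable (fun ω => U ω ^ q) P) (hVi : Integrable (fun ω => V ω ^ q) P)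
    (hU : ∫ ω, U ω ^ q ∂P ≤ a ^ q) (hV : ∫ ω, V ω ^ q ∂P ≤ b ^ q) :
    ∫ ω, (U ω + V ω) ^ q ∂P ≤ (a + b) ^ q := by
  have hpt : ∀ ω, (U ω + V ω) ^ q ≤
      (a + b) ^ q * (a / (a + b) / a ^ q * U ω ^ q + b / (a + b) / b ^ q * V ω ^ q) := by
    intro ω
    have hx : U ω / a ∈ Set.Ici (0 : ℝ) := div_nonneg (hU0 ω) ha.le
    have hy : V ω / b ∈ Set.Ici (0 : ℝ) := div_nonneg (hV0 ω) hb.le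
    have h1 : 0 ≤ a / (a + b) := by positivity
    have h2 : 0 ≤ b / (a + b) := by positivity
    have hc := (convexOn_pow q).2 hx hy h1 h2 (by field_simp)
    simp only [smul_eq_mul, div_pow] at hc
    have e : (U ω + V ω) ^ q =
        (a + b) ^ q * (a / (a + b) * (U ω / a) + b / (a + b) * (V ω / b)) ^ q := by
      rw [← mul_pow]; congr 1; field_simp
    rw [e]
    refine mul_le_mul_of_nonneg_left (hc.trans_eq ?_) (by positivity)
    ring
  calc ∫ ω, (U ω + V ω) ^ q ∂P
      ≤ ∫ ω, (a + b) ^ q * (a / (a + b) / a ^ q * U ω ^ q + b / (a + b) / b ^ q * V ω ^ q) ∂P := by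
        refine integral_mono_of_nonneg (ae_of_all _ fun ω => ?_) ?_ (ae_of_all _ hpt)
        · exact pow_nonneg (add_nonneg (hU0 ω) (hV0 ω)) _
        · exact ((hUi.const_mul _).add (hVi.const_mul _)).const_mul _
    _ = (a + b) ^ q * (a / (a + b) / a ^ q * ∫ ω, U ω ^ q ∂P +
          b / (a + b) / b ^ q * ∫ ω, V ω ^ q ∂P) := by
        rw [integral_const_mul, integral_add (hUi.const_mul _) (hVi.const_mul _),
          integral_const_mul, integral_const_mul]
    _ ≤ (a + b) ^ q * (a / (a + b) / a ^ q * a ^ q + b / (a + b) / b ^ q * b ^ q) := by gcongr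
    _ = (a + b) ^ q := by field_simp

/-- One step of the moment bound for martingales. -/
theorem integral_add_pow_le_of_orthogonal {U V : Ω → ℝ} {a b : ℝ} (ha : 0 < a) (hb : 0 < b) {q : ℕ}
    (hq : 1 ≤ q) (hUi : Integrable (fun ω => U ω ^ (2 * q)) P)
    (hVi : Integrable (fun ω => V ω ^ (2 * q)) P)
    (hUVi : Integrable (fun ω => U ω ^ (2 * q - 1) * V ω) P)
    (hUV2 : Integrable (fun ω => (U ω + V ω) ^ (2 * q)) P)
    (hUV3 : Integrable (fun ω => (U ω ^ 2 + 9 * q * V ω ^ 2) ^ q) P)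
    (hU : ∫ ω, U ω ^ (2 * q) ∂P ≤ a ^ q) (hV : ∫ ω, V ω ^ (2 * q) ∂P ≤ b ^ q)
    (hUV : ∫ ω, U ω ^ (2 * q - 1) * V ω ∂P = 0) :
    ∫ ω, (U ω + V ω) ^ (2 * q) ∂P ≤ (a + 9 * q * b) ^ q := by
  have hq' : (1 : ℝ) ≤ q := by exact_mod_cast hq
  calc ∫ ω, (U ω + V ω) ^ (2 * q) ∂P
      = ∫ ω, ((U ω + V ω) ^ (2 * q) - 2 * q * (U ω ^ (2 * q - 1) * V ω)) ∂P := by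
        rw [integral_sub hUV2 (hUVi.const_mul _), integral_const_mul, hUV, mul_zero, sub_zero]
    _ ≤ ∫ ω, (U ω ^ 2 + 9 * q * V ω ^ 2) ^ q ∂P := by
        refine integral_mono (hUV2.sub (hUVi.const_mul _)) hUV3 fun ω => ?_
        simpa only [mul_assoc] using add_pow_sub_le (U ω) (V ω) hq
    _ ≤ (a + 9 * q * b) ^ q := by
        refine integral_add_pow_le ha (by positivity) (fun ω => by positivity)
          (fun ω => by positivity) ?_ ?_ ?_ ?_
        · simpa only [← pow_mul] using hUi
        · simp only [mul_pow _ _ q, ← pow_mul]; exact hVi.const_mul _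
        · simpa only [← pow_mul] using hU
        · simp only [mul_pow _ _ q, ← pow_mul]
          rw [integral_const_mul]
          gcongr

end Moments

/-! ### Bounded measurable functions, a class in which integrability is automatic -/

/-- Bounded measurable real functions. -/
structure IsBddMeasurable {Ω : Type*} [MeasurableSpace Ω] (g : Ω → ℝ) : Prop where
  measurable : Measurable g
  bounded : ∃ C, ∀ ω, |g ω| ≤ C

namespace IsBddMeasurable

variable {Ω : Type*} [MeasurableSpace Ω] {g g' : Ω → ℝ}

theorem const (c : ℝ) : IsBddMeasurable (fun _ : Ω => c) := ⟨measurable_const, |c|, fun _ => le_rfl⟩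

theorem add (hg : IsBddMeasurable g) (hg' : IsBddMeasurable g') :
    IsBddMeasurable (fun ω => g ω + g' ω) := by
  obtain ⟨C, hC⟩ := hg.bounded
  obtain ⟨C', hC'⟩ := hg'.bounded
  exact ⟨hg.measurable.add hg'.measurable, C + C', fun ω =>
    (abs_add_le _ _).trans (add_le_add (hC ω) (hC' ω))⟩

theorem mul (hg : IsBddMeasurable g) (hg' : IsBddMeasurable g') :
    IsBddMeasurable (fun ω => g ω * g' ω) := by
  obtain ⟨C, hC⟩ := hg.bounded
  obtain ⟨C', hC'⟩ := hg'.bounded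
  refine ⟨hg.measurable.mul hg'.measurable, C * C', fun ω => ?_⟩
  rw [abs_mul]
  exact mul_le_mul (hC ω) (hC' ω) (abs_nonneg _) ((abs_nonneg _).trans (hC ω))

theorem pow (hg : IsBddMeasurable g) (n : ℕ) : IsBddMeasurable (fun ω => g ω ^ n) := by
  obtain ⟨C, hC⟩ := hg.bounded
  refine ⟨hg.measurable.pow_const n, C ^ n, fun ω => ?_⟩
  rw [abs_pow]
  exact pow_le_pow_left₀ (abs_nonneg _) (hC ω) n

theorem sum {κ : Type*} (s : Finset κ) {g : κ → Ω → ℝ} (hg : ∀ k ∈ s, IsBddMeasurable (g k)) :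
    IsBddMeasurable (fun ω => ∑ k ∈ s, g k ω) := by
  classical
  induction s using Finset.induction_on with
  | empty => simpa using const 0
  | insert a s ha ih =>
    simp only [Finset.sum_insert ha]
    exact (hg a (Finset.mem_insert_self _ _)).add
      (ih fun k hk => hg k (Finset.mem_insert_of_mem hk))

theorem comp {Ω' : Type*} [MeasurableSpace Ω'] (hg : IsBddMeasurable g) {φ : Ω' → Ω}
    (hφ : Measurable φ) : IsBddMeasurable (fun ω => g (φ ω)) :=
  ⟨hg.measurable.comp hφ, hg.bounded.imp fun _ hC ω => hC (φ ω)⟩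

theorem integrable (hg : IsBddMeasurable g) (P : Measure Ω) [IsFiniteMeasure P] :
    Integrable g P := by
  obtain ⟨C, hC⟩ := hg.bounded
  exact Integrable.of_bound hg.measurable.aestronglyMeasurable C (ae_of_all _ hC)

end IsBddMeasurable

/-! ### Sums over increasing tuples and their increments -/

section IndexSet

theorem mem_indexSet {r n : ℕ} {i : Fin r → ℕ} :
    i ∈ indexSet r n ↔ (∀ j, i j < n) ∧ StrictMono i := by
  simp [indexSet]

theorem card_indexSet_le (r n : ℕ) : (indexSet r n).card ≤ n ^ r := by
  classical
  refine (Finset.card_filter_le _ _).trans ?_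
  simp

/-- The sum of `f (z_{i_1}, …, z_{i_r})` over increasing tuples with entries less than `n`. -/
def tupleSum {S : Type*} {r : ℕ} (f : (Fin r → S) → ℝ) (n : ℕ) (z : ℕ → S) : ℝ :=
  ∑ i ∈ indexSet r n, f (fun j => z (i j))

variable {S : Type*} {r : ℕ}

theorem strictMono_snoc {i : Fin r → ℕ} {n : ℕ} (hi : StrictMono i) (hn : ∀ j, i j < n) :
    StrictMono (Fin.snoc (α := fun _ => ℕ) i n) := by
  intro a b hab
  induction b using Fin.lastCases with
  | last =>
    induction a using Fin.lastCases with
    | last => exact absurd hab (lt_irrefl _)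
    | cast a => simpa using hn a
  | cast b =>
    induction a using Fin.lastCases with
    | last => exact absurd hab (Fin.le_last _).not_gt
    | cast a => simpa using hi (by simpa using hab)

/-- Tuples are split by whether their largest entry is n. This makes the sum a process in n whose
increment is a sum over shorter tuples with `z n` frozen in the last slot. -/
theorem tupleSum_succ (f : (Fin (r + 1) → S) → ℝ) (n : ℕ) (z : ℕ → S) :
    tupleSum f (n + 1) z =
      tupleSum f n z + tupleSum (fun x => f (Fin.snoc (α := fun _ => S) x (z n))) n z := by
  unfold tupleSum
  rw [← Finset.sum_filter_add_sum_filter_not (indexSet (r + 1) (n + 1))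
    (fun i => i (Fin.last r) < n)]
  congr 1
  · refine Finset.sum_congr ?_ fun _ _ => rfl
    ext i
    simp only [Finset.mem_filter, mem_indexSet]
    constructor
    · rintro ⟨⟨_, h2⟩, h3⟩
      exact ⟨fun j => (h2.monotone (Fin.le_last j)).trans_lt h3, h2⟩
    · rintro ⟨h1, h2⟩
      exact ⟨⟨fun j => (h1 j).trans (Nat.lt_succ_self n), h2⟩, h1 _⟩
  · refine Finset.sum_nbij' (fun i => Fin.init (α := fun _ => ℕ) i)
      (fun i => Fin.snoc (α := fun _ => ℕ) i n) ?_ ?_ ?_ ?_ ?_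
    · intro i hi
      simp only [Finset.mem_filter, mem_indexSet] at hi
      rw [mem_indexSet]
      refine ⟨fun j => ?_, fun a b hab => hi.1.2 (by simpa using hab)⟩
      have h1 := hi.1.2 (Fin.castSucc_lt_last j)
      have h2 := hi.1.1 (Fin.last r)
      simp only [Fin.init]; omega
    · intro i hi
      rw [mem_indexSet] at hi
      simp only [Finset.mem_filter, mem_indexSet]
      refine ⟨⟨fun j => ?_, strictMono_snoc hi.2 hi.1⟩, by simp⟩
      induction j using Fin.lastCases with
      | last => simp
      | cast j => simpa using (hi.1 j).trans (Nat.lt_succ_self n)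
    · intro i hi
      simp only [Finset.mem_filter, mem_indexSet] at hi
      have h2 := hi.1.1 (Fin.last r)
      have : n = i (Fin.last r) := by omega
      rw [this]; exact Fin.snoc_init_self i
    · intro i _
      exact Fin.init_snoc _ _
    · intro i hi
      simp only [Finset.mem_filter, mem_indexSet] at hi
      have h2 := hi.1.1 (Fin.last r)
      have : n = i (Fin.last r) := by omega
      congr 1
      funext j
      induction j using Fin.lastCases with
      | last => simp [← this]
      | cast j => simp [Fin.init]

theorem tupleSum_zero (f : (Fin (r + 1) → S) → ℝ) (z : ℕ → S) : tupleSum f 0 z = 0 := by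
  refine Finset.sum_eq_zero fun i hi => ?_
  exact absurd ((mem_indexSet.1 hi).1 0) (Nat.not_lt_zero _)

theorem tupleSum_of_isEmpty (f : (Fin 0 → S) → ℝ) (n : ℕ) (z : ℕ → S) :
    tupleSum f n z = f (fun j => j.elim0) := by
  have : indexSet 0 n = {fun j => j.elim0} := by
    ext i
    rw [mem_indexSet, Finset.mem_singleton]
    exact ⟨fun _ => funext fun j => j.elim0, fun _ => ⟨fun j => j.elim0, fun j => j.elim0⟩⟩
  rw [tupleSum, this, Finset.sum_singleton]
  congr 1; funext j; exact j.elim0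

/-- Adaptedness: only entries before time n matter, so `z n` can be integrated out separately. -/
theorem tupleSum_update (f : (Fin r → S) → ℝ) (n : ℕ) (z : ℕ → S) (x : S) :
    tupleSum f n (Function.update z n x) = tupleSum f n z := by
  refine Finset.sum_congr rfl fun i hi => ?_
  congr 1; funext j
  exact Function.update_of_ne ((mem_indexSet.1 hi).1 j).ne _ _

theorem snoc_update_castSucc (x : Fin r → S) (a y : S) (j : Fin r) :
    Function.update (Fin.snoc (α := fun _ => S) x a) j.castSucc y =
      Fin.snoc (α := fun _ => S) (Function.update x j y) a := by
  exact (Fin.snoc_update (α := fun _ => S) a x j y).symm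

variable [MeasurableSpace S]

theorem IsBddMeasurable.tupleSum {f : (Fin r → S) → ℝ} (hf : IsBddMeasurable f) (n : ℕ) :
    IsBddMeasurable (tupleSum f n) :=
  IsBddMeasurable.sum _ fun i _ => hf.comp
    (measurable_pi_lambda (fun (z : ℕ → S) j => z (i j)) fun j => measurable_pi_apply (i j))

theorem measurable_snoc :
    Measurable (fun p : (Fin r → S) × S => Fin.snoc (α := fun _ => S) p.1 p.2) := by
  refine measurable_pi_iff.2 fun j => ?_
  induction j using Fin.lastCases with
  | last => simpa using measurable_snd
  | cast j =>
    simpa [Function.comp_def] using (measurable_pi_apply (X := fun _ => S) j).comp measurable_fst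

theorem IsBddMeasurable.snoc {f : (Fin (r + 1) → S) → ℝ} (hf : IsBddMeasurable f) (a : S) :
    IsBddMeasurable (fun x => f (Fin.snoc (α := fun _ => S) x a)) :=
  hf.comp (measurable_snoc.comp (measurable_id.prodMk measurable_const))

theorem IsBddMeasurable.increment {f : (Fin (r + 1) → S) → ℝ} (hf : IsBddMeasurable f) (n : ℕ) :
    IsBddMeasurable (fun z : ℕ → S =>
      UStat.tupleSum (fun x => f (Fin.snoc (α := fun _ => S) x (z n))) n z) :=
  IsBddMeasurable.sum _ fun i _ => hf.comp (measurable_snoc.comp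
    (((measurable_pi_lambda (fun (z : ℕ → S) j => z (i j)) fun j =>
      measurable_pi_apply (i j)).prodMk (measurable_pi_apply n))))

end IndexSet

/-! ### Moment bound by induction on the number of variables -/

/-- A moment bound for sums over increasing tuples of a bounded kernel: each coordinate in which
the kernel is centered saves a factor `9 q / M`. -/
theorem integral_tupleSum_pow_le {S : Type*} [MeasurableSpace S] (μ : Measure S)
    [IsProbabilityMeasure μ] {q M : ℕ} (hq : 1 ≤ q) {b : ℝ} (hb : 0 < b) :
    ∀ {r : ℕ} {f : (Fin r → S) → ℝ}, Measurable f → (∀ x, |f x| ≤ b) →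
    ∀ {c : Fin r → ℝ}, (∀ j, c j = (M : ℝ) ^ 2 ∨ (c j = 9 * q * M ∧
      ∀ x, ∫ y, f (Function.update x j y) ∂μ = 0)) →
    ∀ {n : ℕ}, n < M →
    ∫ z, tupleSum f n z ^ (2 * q) ∂(iidLaw ℕ μ) ≤ ((∏ j, c j) * b ^ 2) ^ q := by
  intro r
  induction r with
  | zero =>
    intro f _ hfb c _ n _
    simp only [tupleSum_of_isEmpty, integral_const, probReal_univ, one_smul, Finset.univ_eq_empty,
      Finset.prod_empty, one_mul, pow_mul]
    refine pow_le_pow_left₀ (by positivity) ?_ q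
    rw [← sq_abs]; exact pow_le_pow_left₀ (abs_nonneg _) (hfb _) 2
  | succ r ih =>
    intro f hf hfb c hc
    have hfB : IsBddMeasurable f := ⟨hf, b, hfb⟩
    intro N hN
    have hM : (0 : ℝ) < M := by exact_mod_cast (Nat.zero_le N).trans_lt hN
    have hq0 : (0 : ℝ) < q := by exact_mod_cast hq
    have hcpos : ∀ j, 0 < c j := fun j => by
      rcases hc j with h | ⟨h, _⟩ <;> rw [h] <;> positivity
    set β : ℝ := (∏ j : Fin r, c j.castSucc) * b ^ 2 with hβ
    have hβ0 : 0 < β := mul_pos (Finset.prod_pos fun j _ => hcpos _) (by positivity)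
    set D : ℕ → (ℕ → S) → ℝ :=
      fun n z => tupleSum (fun x => f (Fin.snoc (α := fun _ => S) x (z n))) n z with hD
    have hDB : ∀ n, IsBddMeasurable (D n) := fun n => hfB.increment n
    have hUB : ∀ n, IsBddMeasurable (tupleSum f n) := fun n => hfB.tupleSum n
    have hDup : ∀ n z x, D n (Function.update z n x) =
        tupleSum (fun y => f (Fin.snoc (α := fun _ => S) y x)) n z := by
      intro n z x
      simp only [hD, Function.update_self]
      exact tupleSum_update _ n z x
    -- By Fubini, freeze `z n`: the increment becomes a tuple sum in one variable fewer, with the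
    -- same centering in the remaining coordinates.
    have hDm : ∀ n, n < M → ∫ z, D n z ^ (2 * q) ∂(iidLaw ℕ μ) ≤ β ^ q := by
      intro n hn
      have hint := ((hDB n).pow (2 * q)).integrable (iidLaw ℕ μ)
      rw [integral_iidLaw_update μ n hint]
      have hjm : Measurable (fun p : (ℕ → S) × S => Function.update p.1 n p.2) := by fun_prop
      rw [integral_integral_swap ((((hDB n).pow (2 * q)).comp hjm).integrable _)]
      calc _ ≤ ∫ _ : S, β ^ q ∂μ := by
            refine integral_mono_of_nonneg (ae_of_all _ fun x => integral_nonneg fun z => ?_)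
              (integrable_const _) (ae_of_all _ fun x => ?_)
            · simp only [pow_mul]; positivity
            · simp only [hDup]
              refine ih (hfB.snoc x).measurable (fun _ => hfb _) (fun j => ?_) hn
              refine (hc j.castSucc).imp id fun h => ⟨h.1, fun y => ?_⟩
              simpa only [snoc_update_castSucc] using h.2 (Fin.snoc (α := fun _ => S) y x)
        _ = β ^ q := by simp
    rw [Fin.prod_univ_castSucc, show (∏ j : Fin r, c j.castSucc) * c (Fin.last r) * b ^ 2 =
      c (Fin.last r) * β by rw [hβ]; ring]
    rcases hc (Fin.last r) with hlast | ⟨hlast, hzero⟩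
    -- No centering in the last coordinate: the triangle inequality adds √β per step. The factor n +
    -- 1, rather than n, keeps the bound positive at n = 0, as the one-step lemma requires.
    · have key : ∀ n, n < M →
          ∫ z, |tupleSum f n z| ^ (2 * q) ∂(iidLaw ℕ μ) ≤ ((n + 1) * √β) ^ (2 * q) := by
        intro n
        induction n with
        | zero =>
          intro _
          simp only [tupleSum_zero]
          rw [abs_zero, zero_pow (by omega), integral_zero]
          positivity
        | succ n ihn =>
          intro hn
          have h1 := (hUB n).pow (2 * q)
          have h2 := (hDB n).pow (2 * q)
          have e1 : ∀ z, |tupleSum f n z| ^ (2 * q) = tupleSum f n z ^ (2 * q) := fun z => by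
            rw [pow_mul, sq_abs, pow_mul]
          have e2 : ∀ z, |D n z| ^ (2 * q) = D n z ^ (2 * q) := fun z => by
            rw [pow_mul, sq_abs, pow_mul]
          have h3 : ∀ z, |tupleSum f (n + 1) z| ^ (2 * q) ≤
              (|tupleSum f n z| + |D n z|) ^ (2 * q) := fun z => by
            rw [tupleSum_succ]
            exact pow_le_pow_left₀ (abs_nonneg _) (abs_add_le _ _) _
          have hab : ∀ {g : (ℕ → S) → ℝ}, IsBddMeasurable g → IsBddMeasurable (fun z => |g z|) :=
            fun hg => ⟨hg.measurable.abs, by simpa only [abs_abs] using hg.bounded⟩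
          calc _ ≤ ∫ z, (|tupleSum f n z| + |D n z|) ^ (2 * q) ∂(iidLaw ℕ μ) :=
                integral_mono (((hab (hUB _)).pow _).integrable _)
                  ((((hab (hUB _)).add (hab (hDB _))).pow _).integrable _) h3
            _ ≤ ((n + 1) * √β + √β) ^ (2 * q) := by
                refine integral_add_pow_le (by positivity) (by positivity)
                  (fun _ => abs_nonneg _) (fun _ => abs_nonneg _)
                  (((hab (hUB _)).pow _).integrable _)
                  (((hab (hDB _)).pow _).integrable _) (ihn (by omega)) ?_
                simp only [e2]
                rw [pow_mul (√β), Real.sq_sqrt hβ0.le]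
                exact hDm n (by omega)
            _ = _ := by push_cast; ring
      have h := key N hN
      have e1 : ∀ z, |tupleSum f N z| ^ (2 * q) = tupleSum f N z ^ (2 * q) := fun z => by
        rw [pow_mul, sq_abs, pow_mul]
      simp only [e1] at h
      refine h.trans ?_
      rw [pow_mul, mul_pow, Real.sq_sqrt hβ0.le, hlast]
      have : ((N : ℝ) + 1) ≤ M := by exact_mod_cast hN
      gcongr
    -- Last coordinate centered: the increments are orthogonal to odd powers of the past, so each
    -- step adds only 9qβ to the base.
    · have key : ∀ n, n < M →
          ∫ z, tupleSum f n z ^ (2 * q) ∂(iidLaw ℕ μ) ≤ ((n + 1) * (9 * q * β)) ^ q := by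
        intro n
        induction n with
        | zero =>
          intro _
          simp only [tupleSum_zero]
          rw [zero_pow (by omega), integral_zero]
          positivity
        | succ n ihn =>
          intro hn
          simp only [tupleSum_succ]
          refine (integral_add_pow_le_of_orthogonal (a := (n + 1) * (9 * q * β)) (b := β)
            (by positivity) hβ0 hq (((hUB n).pow _).integrable _)
            (((hDB n).pow _).integrable _) ((((hUB n).pow _).mul (hDB n)).integrable _)
            ((((hUB n).add (hDB n)).pow _).integrable _)
            (((((hUB n).pow 2).add
              ((IsBddMeasurable.const _).mul ((hDB n).pow 2))).pow q).integrable _)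
            (ihn (by omega)) (hDm n (by omega)) ?_).trans_eq (by push_cast; ring)
          rw [integral_iidLaw_update μ n ((((hUB n).pow _).mul (hDB n)).integrable _)]
          refine integral_eq_zero_of_ae (ae_of_all _ fun z => ?_)
          simp only [tupleSum_update, hDup, Pi.zero_apply]
          rw [integral_const_mul]
          refine mul_eq_zero_of_right _ ?_
          unfold tupleSum
          rw [integral_finsetSum]
          · refine Finset.sum_eq_zero fun i _ => ?_
            obtain ⟨s⟩ : Nonempty S := ⟨z 0⟩
            have := hzero (Fin.snoc (α := fun _ => S) (fun j => z (i j)) s)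
            simpa only [Fin.update_snoc_last] using this
          · intro i _
            have hm : Measurable (fun y : S => ((fun j => z (i j) : Fin r → S), y)) := by fun_prop
            exact (hfB.comp (measurable_snoc.comp hm)).integrable μ
      refine (key N hN).trans ?_
      rw [hlast]
      have : ((N : ℝ) + 1) ≤ M := by exact_mod_cast hN
      calc _ ≤ (M * (9 * q * β)) ^ q := by gcongr
        _ = _ := by ring

/-! ### Hoeffding decomposition -/

section Hoeffding

variable {ι S : Type*} [DecidableEq ι] [MeasurableSpace S] (μ : Measure S)
  [IsProbabilityMeasure μ]

/-- Integrate out the coordinates outside of `B`. -/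
noncomputable def marginal (B : Finset ι) (f : (ι → S) → ℝ) (x : ι → S) : ℝ :=
  ∫ z, f (B.piecewise x z) ∂(iidLaw ι μ)

/-- The component of the Hoeffding decomposition of `f` that belongs to `A`. -/
noncomputable def component (A : Finset ι) (f : (ι → S) → ℝ) (x : ι → S) : ℝ :=
  ∑ B ∈ A.powerset, (-1) ^ A.card * (-1) ^ B.card * marginal μ B f x

variable {f : (ι → S) → ℝ}

theorem abs_marginal_le {b : ℝ} (hb : ∀ x, |f x| ≤ b) (B : Finset ι) (x : ι → S) :
    |marginal μ B f x| ≤ b := by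
  have := norm_integral_le_of_norm_le_const (μ := iidLaw ι μ)
    (f := fun z => f (B.piecewise x z)) (C := b) (ae_of_all _ fun z => hb _)
  simpa [marginal] using this

theorem IsBddMeasurable.marginal (hf : IsBddMeasurable f) (B : Finset ι) :
    IsBddMeasurable (marginal μ B f) := by
  refine ⟨?_, hf.bounded.imp fun b hb x => abs_marginal_le μ hb B x⟩
  exact ((hf.comp (measurable_piecewise_prod B)).measurable.stronglyMeasurable.integral_prod_right
    (ν := iidLaw ι μ)).measurable

theorem IsBddMeasurable.component (hf : IsBddMeasurable f) (A : Finset ι) :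
    IsBddMeasurable (component μ A f) :=
  IsBddMeasurable.sum _ fun B _ => (IsBddMeasurable.const _).mul (hf.marginal μ B)

theorem abs_component_le {b : ℝ} (hb : ∀ x, |f x| ≤ b) (A : Finset ι) (x : ι → S) :
    |component μ A f x| ≤ 2 ^ A.card * b := by
  refine (Finset.abs_sum_le_sum_abs _ _).trans ?_
  refine (Finset.sum_le_sum (g := fun _ => b) fun B _ => ?_).trans_eq ?_
  · rw [abs_mul, abs_mul, abs_pow, abs_pow, abs_neg, abs_one, one_pow, one_pow, one_mul, one_mul]
    exact abs_marginal_le μ hb B x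
  · rw [Finset.sum_const, Finset.card_powerset, nsmul_eq_mul]; push_cast; rfl

theorem measurable_piecewise_right (B : Finset ι) (x : ι → S) :
    Measurable (fun z : ι → S => B.piecewise x z) :=
  (measurable_piecewise_prod B).comp (measurable_const.prodMk measurable_id)

theorem integral_marginal_update (hf : IsBddMeasurable f) (B : Finset ι) (x : ι → S) (j : ι) :
    ∫ y, marginal μ B f (Function.update x j y) ∂μ = marginal μ (B.erase j) f x := by
  by_cases hj : j ∈ B
  · have e : ∀ y z, B.piecewise (Function.update x j y) z =
        (B.erase j).piecewise x (Function.update z j y) := by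
      intro y z
      funext k
      rcases eq_or_ne k j with rfl | hk
      · simp [Finset.piecewise, hj]
      · simp [Finset.piecewise, hk]
    have hG := hf.comp (measurable_piecewise_right (B.erase j) x)
    have hjm : Measurable (fun p : (ι → S) × S => Function.update p.1 j p.2) := by fun_prop
    simp only [marginal, e]
    rw [integral_iidLaw_update μ j (hG.integrable _)]
    exact (integral_integral_swap ((hG.comp hjm).integrable _)).symm
  · have e : ∀ y z, B.piecewise (Function.update x j y) z = B.piecewise x z := by
      intro y z
      funext k
      by_cases hk : k ∈ B
      · have : k ≠ j := fun h => hj (h ▸ hk)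
        simp [Finset.piecewise, hk, this]
      · simp [Finset.piecewise, hk]
    rw [Finset.erase_eq_of_notMem hj]
    simp [marginal, e]

/-- Subsets of A pair up as t and `insert j t`; after integrating out coordinate j both have the
same marginal, with opposite signs. -/
theorem integral_component_update (hf : IsBddMeasurable f) {A : Finset ι} {j : ι} (hj : j ∈ A)
    (x : ι → S) : ∫ y, component μ A f (Function.update x j y) ∂μ = 0 := by
  unfold component
  rw [integral_finsetSum]
  · simp only [integral_const_mul, integral_marginal_update μ hf]
    obtain ⟨A', hA', rfl⟩ : ∃ A', j ∉ A' ∧ A = insert j A' :=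
      ⟨A.erase j, Finset.notMem_erase _ _, (Finset.insert_erase hj).symm⟩
    rw [Finset.sum_powerset_insert hA', ← Finset.sum_add_distrib]
    refine Finset.sum_eq_zero fun t ht => ?_
    have hjt : j ∉ t := fun h => hA' (Finset.mem_powerset.1 ht h)
    rw [Finset.erase_insert hjt, Finset.erase_eq_of_notMem hjt, Finset.card_insert_of_notMem hjt]
    ring
  · intro B _
    exact (((IsBddMeasurable.const _).mul (hf.marginal μ B)).comp
      (measurable_update x)).integrable _

/-- Möbius inversion on subsets: after exchanging the sums, only B = `univ` survives, and its
marginal is f. -/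
theorem sum_component [Fintype ι] (x : ι → S) :
    ∑ A : Finset ι, component μ A f x = f x := by
  have key : ∀ B : Finset ι, ∑ A : Finset ι, (if B ⊆ A then (-1 : ℝ) ^ A.card else 0) =
      if B = Finset.univ then (-1) ^ (Finset.univ : Finset ι).card else 0 := by
    intro B
    -- The alternating sum over A ⊇ B is the expansion of a product whose factors are -1 on B and 0
    -- off B.
    have h := Finset.prod_add (fun _ : ι => (-1 : ℝ)) (fun j => if j ∈ B then 0 else 1) Finset.univ
    rw [Finset.powerset_univ] at h
    have hl : ∏ j : ι, ((-1 : ℝ) + if j ∈ B then 0 else 1) =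
        if B = Finset.univ then (-1) ^ (Finset.univ : Finset ι).card else 0 := by
      split_ifs with hB
      · subst hB; simp
      · obtain ⟨j, hj⟩ : ∃ j, j ∉ B := by
          by_contra! H; exact hB (Finset.eq_univ_iff_forall.2 H)
        exact Finset.prod_eq_zero (Finset.mem_univ j) (by simp [hj])
    rw [← hl, h]
    refine Finset.sum_congr rfl fun A _ => ?_
    rw [Finset.prod_const]
    split_ifs with hBA
    · rw [Finset.prod_eq_one, mul_one]
      intro j hj
      have : j ∉ B := fun h => (Finset.mem_sdiff.1 hj).2 (hBA h)
      simp [this]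
    · obtain ⟨j, hj, hjA⟩ := Finset.not_subset.1 hBA
      rw [Finset.prod_eq_zero (i := j) (by simp [hjA]) (by simp [hj]), mul_zero]
  have h1 : ∀ A : Finset ι, component μ A f x =
      ∑ B : Finset ι, (if B ⊆ A then (-1 : ℝ) ^ A.card else 0) *
        ((-1) ^ B.card * marginal μ B f x) := by
    intro A
    rw [component, ← Finset.sum_subset (Finset.subset_univ A.powerset)]
    · refine Finset.sum_congr rfl fun B hB => ?_
      rw [if_pos (Finset.mem_powerset.1 hB), mul_assoc]
    · intro B _ hB
      rw [if_neg (fun h => hB (Finset.mem_powerset.2 h)), zero_mul]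
  simp only [h1]
  rw [Finset.sum_comm]
  simp_rw [← Finset.sum_mul, key, ite_mul, zero_mul]
  rw [Finset.sum_ite_eq' Finset.univ Finset.univ, if_pos (Finset.mem_univ _), ← mul_assoc,
    ← mul_pow]
  simp [marginal]

/-- If `h` is orthogonal to all functions of the coordinates in `B`, then the marginals over `B` of
functions close to `h` are small. -/
theorem integral_abs_marginal_le (hf : IsBddMeasurable f) {h : (ι → S) → ℝ}
    (hh : Integrable h (iidLaw ι μ)) {B : Finset ι}
    (horth : ∀ ψ : (ι → S) → ℝ, IsBddMeasurable ψ → (∀ x z, ψ (B.piecewise x z) = ψ x) →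
      ∫ x, ψ x * h x ∂(iidLaw ι μ) = 0) :
    ∫ x, |marginal μ B f x| ∂(iidLaw ι μ) ≤ ∫ x, |h x - f x| ∂(iidLaw ι μ) := by
  -- L¹ duality: the sign of the marginal depends only on coordinates in B, so pairing it with f
  -- gives the L¹ norm of the marginal, while pairing it with h gives 0.
  set ψ : (ι → S) → ℝ := fun x => if 0 ≤ marginal μ B f x then 1 else -1 with hψ
  have hψ1 : ∀ x, |ψ x| ≤ 1 := fun x => by
    simp only [hψ]; split_ifs <;> simp
  have hψB : IsBddMeasurable ψ := by
    refine ⟨Measurable.ite (measurableSet_le measurable_const (hf.marginal μ B).measurable)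
      measurable_const measurable_const, 1, hψ1⟩
  have hpw : ∀ x z, ψ (B.piecewise x z) = ψ x := by
    intro x z
    have : marginal μ B f (B.piecewise x z) = marginal μ B f x := by
      unfold marginal
      refine integral_congr_ae (ae_of_all _ fun y => ?_)
      simp only
      congr 1
      funext k
      by_cases hk : k ∈ B <;> simp [Finset.piecewise, hk]
    simp only [hψ, this]
  have e1 : ∫ x, |marginal μ B f x| ∂(iidLaw ι μ) = ∫ x, ψ x * f x ∂(iidLaw ι μ) := by
    rw [integral_iidLaw_piecewise μ B ((hψB.mul hf).integrable _)]
    refine integral_congr_ae (ae_of_all _ fun x => ?_)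
    simp only [hpw]
    rw [integral_const_mul]
    simp only [hψ]
    split_ifs with h0
    · rw [abs_of_nonneg h0, one_mul]; rfl
    · rw [abs_of_neg (not_le.1 h0), neg_one_mul]; rfl
  have hψh : Integrable (fun x => ψ x * h x) (iidLaw ι μ) :=
    hh.bdd_mul hψB.measurable.aestronglyMeasurable (ae_of_all _ hψ1)
  have e2 : ∫ x, ψ x * f x ∂(iidLaw ι μ) = ∫ x, -(ψ x * (h x - f x)) ∂(iidLaw ι μ) := by
    have : ∀ x, -(ψ x * (h x - f x)) = ψ x * f x - ψ x * h x := fun x => by ring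
    simp only [this]
    rw [integral_sub ((hψB.mul hf).integrable _) hψh, horth ψ hψB hpw, sub_zero]
  rw [e1, e2]
  refine integral_mono ?_ (hh.sub (hf.integrable _)).abs fun x => ?_
  · exact ((hh.sub (hf.integrable _)).bdd_mul hψB.measurable.aestronglyMeasurable
      (ae_of_all _ hψ1)).neg
  · refine (le_abs_self _).trans ?_
    rw [abs_neg, abs_mul]
    exact mul_le_of_le_one_left (abs_nonneg _) (hψ1 x)

end Hoeffding

/-! ### Linearity and L¹ bounds for tuple sums -/

section TupleSum

variable {S : Type*} {r : ℕ}

theorem tupleSum_add (f g : (Fin r → S) → ℝ) (n : ℕ) (z : ℕ → S) :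
    tupleSum (fun x => f x + g x) n z = tupleSum f n z + tupleSum g n z :=
  Finset.sum_add_distrib

theorem tupleSum_sum {κ : Type*} (s : Finset κ) (f : κ → (Fin r → S) → ℝ) (n : ℕ) (z : ℕ → S) :
    tupleSum (fun x => ∑ k ∈ s, f k x) n z = ∑ k ∈ s, tupleSum (f k) n z :=
  Finset.sum_comm

variable [MeasurableSpace S] (μ : Measure S) [IsProbabilityMeasure μ]

theorem integrable_tupleSum {f : (Fin r → S) → ℝ} (hf : Integrable f (iidLaw (Fin r) μ)) (n : ℕ) :
    Integrable (tupleSum f n) (iidLaw ℕ μ) :=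
  integrable_finsetSum _ fun _ hi => integrable_comp_iidLaw μ (mem_indexSet.1 hi).2.injective hf

theorem integral_abs_tupleSum_le {f : (Fin r → S) → ℝ} (hf : Integrable f (iidLaw (Fin r) μ))
    (n : ℕ) :
    ∫ z, |tupleSum f n z| ∂(iidLaw ℕ μ) ≤ (n : ℝ) ^ r * ∫ x, |f x| ∂(iidLaw (Fin r) μ) := by
  have hint : ∀ i ∈ indexSet r n,
      Integrable (fun z : ℕ → S => |f (fun j => z (i j))|) (iidLaw ℕ μ) :=
    fun i hi => (integrable_comp_iidLaw μ (mem_indexSet.1 hi).2.injective hf).abs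
  calc ∫ z, |tupleSum f n z| ∂(iidLaw ℕ μ)
      ≤ ∫ z, ∑ i ∈ indexSet r n, |f (fun j => z (i j))| ∂(iidLaw ℕ μ) :=
        integral_mono (integrable_tupleSum μ hf n).abs (integrable_finsetSum _ hint)
          fun z => Finset.abs_sum_le_sum_abs _ _
    _ = ∑ i ∈ indexSet r n, ∫ x, |f x| ∂(iidLaw (Fin r) μ) := by
        rw [integral_finsetSum _ hint]
        refine Finset.sum_congr rfl fun i hi => ?_
        exact integral_comp_iidLaw μ (mem_indexSet.1 hi).2.injective
          (G := fun x => |f x|) hf.abs.aestronglyMeasurable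
    _ ≤ _ := by
        rw [Finset.sum_const, nsmul_eq_mul]
        refine mul_le_mul_of_nonneg_right ?_ (integral_nonneg fun _ => abs_nonneg _)
        exact_mod_cast card_indexSet_le r n

end TupleSum

/-! ### Degeneracy as orthogonality to functions of few coordinates -/

section Degenerate

variable {Ω S : Type*} [MeasurableSpace Ω] [MeasurableSpace S] {P : Measure Ω}
  {X : ℕ → Ω → S}

theorem IsIID.map_eq [IsProbabilityMeasure (P.map (X 0))] (hX : IsIID X P) :
    P.map (fun ω k => X k ω) = iidLaw ℕ (P.map (X 0)) := by
  have h := hX.indep.map_fun_eq_infinitePi_map hX.measurable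
  rw [h]
  congr 1
  funext k
  exact (hX.identDistrib k).map_eq

theorem IsIID.map_initial_eq [IsProbabilityMeasure (P.map (X 0))] (hX : IsIID X P) (r : ℕ) :
    P.map (fun ω (j : Fin r) => X (j : ℕ) ω) = iidLaw (Fin r) (P.map (X 0)) := by
  have hm : Measurable (fun ω k => X k ω) := measurable_pi_iff.2 hX.measurable
  have h2 : (iidLaw ℕ (P.map (X 0))).map (fun z (j : Fin r) => z (j : ℕ)) =
      iidLaw (Fin r) (P.map (X 0)) :=
    Measure.map_infinitePi_infinitePi_of_inj Fin.val_injective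
  rw [← h2, ← hX.map_eq, Measure.map_map (by fun_prop) hm]
  rfl

/-- Degeneracy concerns the first d variables only; by symmetry of the kernel, such a permutation
transfers it to any B of at most d coordinates. -/
theorem exists_perm_lt {r d : ℕ} {B : Finset (Fin r)} (hB : B.card ≤ d) :
    ∃ σ : Equiv.Perm (Fin r), ∀ j ∈ B, ((σ j : Fin r) : ℕ) < d := by
  classical
  have hr : B.card ≤ r := by simpa using B.card_le_univ
  have hc : Fintype.card {j // j ∈ B} = Fintype.card {j : Fin r // (j : ℕ) < B.card} := by
    rw [Fintype.card_coe, Fintype.card_subtype]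
    have : (Finset.univ.filter fun j : Fin r => (j : ℕ) < B.card) =
        Finset.univ.map (Fin.castLEEmb hr) := by
      ext j
      simp only [Finset.mem_filter, Finset.mem_univ, true_and, Finset.mem_map]
      constructor
      · intro h; exact ⟨⟨j, h⟩, rfl⟩
      · rintro ⟨k, rfl⟩; exact k.2
    rw [this, Finset.card_map, Finset.card_univ, Fintype.card_fin]
  refine ⟨(Fintype.equivOfCardEq hc).extendSubtype, fun j hj => ?_⟩
  exact ((Fintype.equivOfCardEq hc).extendSubtype_mem j hj).trans_le hB

/-- A degenerate kernel is orthogonal to the functions of few coordinates. -/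
theorem integral_mul_eq_zero_of_condExp_eq_zero [IsProbabilityMeasure P]
    [IsProbabilityMeasure (P.map (X 0))]
    (hX : IsIID X P) {r d : ℕ} {h : (Fin r → S) → ℝ} (hmeas : Measurable h)
    (hsymm : IsSymmetric h) (hint : Integrable (kernelVar h X) P)
    (hcond : P[kernelVar h X | sigmaFirst X d] =ᵐ[P] 0) {B : Finset (Fin r)} (hB : B.card ≤ d)
    {ψ : (Fin r → S) → ℝ} (hψ : IsBddMeasurable ψ) (hpw : ∀ x z, ψ (B.piecewise x z) = ψ x) :
    ∫ x, ψ x * h x ∂(iidLaw (Fin r) (P.map (X 0))) = 0 := by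
  obtain ⟨σ, hσ⟩ := exists_perm_lt hB
  obtain ⟨ω₀⟩ : Nonempty Ω := nonempty_of_isProbabilityMeasure P
  set Ψ : Ω → ℝ := fun ω => ψ (fun j => X (σ j : Fin r) ω) with hΨ
  have hm : sigmaFirst X d ≤ ‹MeasurableSpace Ω› :=
    iSup_le fun k => (hX.measurable k).comap_le
  have hΨm : StronglyMeasurable[sigmaFirst X d] Ψ := by
    -- Coordinates outside B are replaced by a constant, so that only the first d variables enter.
    have e : Ψ = fun ω => ψ (B.piecewise (fun j => X (σ j : Fin r) ω) (fun _ => X 0 ω₀)) := by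
      funext ω; rw [hpw]
    rw [e]
    suffices H : Measurable[sigmaFirst X d]
        (fun ω => B.piecewise (fun j => X (σ j : Fin r) ω) (fun _ => X 0 ω₀)) from
      (hψ.measurable.comp H).stronglyMeasurable
    refine (@measurable_pi_iff _ _ _ (sigmaFirst X d) _ _).2 fun j => ?_
    by_cases hj : j ∈ B
    · simp only [Finset.piecewise, hj, if_true]
      exact (comap_measurable _).mono (le_iSup
        (fun k : Fin d => MeasurableSpace.comap (X (k : ℕ)) inferInstance) ⟨σ j, hσ j hj⟩) le_rfl
    · simp only [Finset.piecewise, hj, if_false]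
      exact measurable_const
  obtain ⟨C, hC⟩ := hψ.bounded
  have hprod : Integrable (Ψ * kernelVar h X) P :=
    hint.bdd_mul (hΨm.mono hm).aestronglyMeasurable (ae_of_all _ fun ω => hC _)
  have h1 : ∫ ω, (Ψ * kernelVar h X) ω ∂P = 0 := by
    rw [← integral_condExp hm]
    refine integral_eq_zero_of_ae ?_
    filter_upwards [condExp_mul_of_stronglyMeasurable_left hΨm hprod hint, hcond] with ω h1 h2
    rw [h1, Pi.mul_apply, h2]
    simp
  have hψh : Measurable fun x => ψ x * h x := hψ.measurable.mul hmeas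
  rw [← integral_comp_iidLaw (P.map (X 0)) σ.injective hψh.aestronglyMeasurable]
  have e2 : ∀ x : Fin r → S, h (fun j => x (σ j)) = h x := hsymm σ
  simp only [e2]
  have hXm : Measurable (fun ω (j : Fin r) => X (j : ℕ) ω) :=
    measurable_pi_iff.2 fun j => hX.measurable j
  rw [← hX.map_initial_eq r, integral_map hXm.aemeasurable]
  · exact h1
  · refine Measurable.aestronglyMeasurable (Measurable.mul (hψ.measurable.comp ?_) hmeas)
    exact measurable_pi_lambda _ fun j => measurable_pi_apply (σ j)

end Degenerate

/-! ### Truncation error under exponential moments -/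

section Truncation

variable {Ω : Type*}

/-- Truncation of a function at level `L`. -/
noncomputable def trunc (h : Ω → ℝ) (L : ℝ) (x : Ω) : ℝ := if |h x| ≤ L then h x else 0

theorem abs_trunc_le (h : Ω → ℝ) {L : ℝ} (hL : 0 ≤ L) (x : Ω) : |trunc h L x| ≤ L := by
  unfold trunc; split_ifs with hx
  · exact hx
  · simpa using hL

variable [MeasurableSpace Ω]

theorem measurable_trunc {h : Ω → ℝ} (hh : Measurable h) (L : ℝ) : Measurable (trunc h L) :=
  Measurable.ite (measurableSet_le hh.abs measurable_const) hh measurable_const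

theorem le_factorial_mul_exp_rpow {γ : ℝ} {m : ℕ} (hm : 1 ≤ m * γ) {x : ℝ} (hx : 0 ≤ x) :
    x ≤ m.factorial * Real.exp (x ^ γ) := by
  have hf : (1 : ℝ) ≤ m.factorial := by exact_mod_cast m.factorial_pos
  have hx0 : 0 ≤ x ^ γ := Real.rpow_nonneg hx _
  rcases le_total x 1 with h1 | h1
  · nlinarith [Real.one_le_exp hx0]
  · calc x = x ^ (1 : ℝ) := (Real.rpow_one x).symm
      _ ≤ x ^ (m * γ) := Real.rpow_le_rpow_of_exponent_le h1 hm
      _ = (x ^ γ) ^ m := by rw [mul_comm, Real.rpow_mul hx, Real.rpow_natCast]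
      _ ≤ m.factorial * Real.exp (x ^ γ) := by
        have := Real.pow_div_factorial_le_exp _ hx0 m
        rwa [div_le_iff₀ (by positivity), mul_comm] at this

/-- Where |h| > L, exp(-R L^γ) exp(R |h|^γ) ≥ 1. The moment is taken at R + 1, and the spare
exp(|h|^γ) dominates |h| up to a constant. -/
theorem exists_integral_abs_sub_trunc_le {ρ : Measure Ω} {h : Ω → ℝ}
    {γ : ℝ} (hγ : 0 < γ) (hexp : ∀ R : ℝ, 0 < R → Integrable (fun x => Real.exp (R * |h x| ^ γ)) ρ)
    {R : ℝ} (hR : 0 < R) :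
    ∃ C, 0 ≤ C ∧ ∀ L, 0 ≤ L → ∫ x, |h x - trunc h L x| ∂ρ ≤ C * Real.exp (-(R * L ^ γ)) := by
  obtain ⟨m, hm⟩ := exists_nat_ge (1 / γ)
  rw [div_le_iff₀ hγ] at hm
  refine ⟨m.factorial * ∫ x, Real.exp ((R + 1) * |h x| ^ γ) ∂ρ, ?_, fun L hL => ?_⟩
  · exact mul_nonneg (by positivity) (integral_nonneg fun _ => (Real.exp_pos _).le)
  calc ∫ x, |h x - trunc h L x| ∂ρ
      ≤ ∫ x, m.factorial * Real.exp (-(R * L ^ γ)) * Real.exp ((R + 1) * |h x| ^ γ) ∂ρ := by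
        refine integral_mono_of_nonneg (ae_of_all _ fun _ => abs_nonneg _)
          ((hexp (R + 1) (by linarith)).const_mul _) (ae_of_all _ fun x => ?_)
        simp only [trunc]
        split_ifs with hx
        · rw [sub_self, abs_zero]; positivity
        · rw [sub_zero]
          refine (le_factorial_mul_exp_rpow hm (abs_nonneg (h x))).trans ?_
          rw [mul_assoc, ← Real.exp_add]
          have := Real.rpow_le_rpow hL (not_le.1 hx).le hγ.le
          gcongr
          nlinarith
    _ = _ := by rw [integral_const_mul]; ring

end Truncation

/-! ### Deviation inequality for a fixed number of observations -/

section Deviation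

variable {S : Type*} [MeasurableSpace S] (μ : Measure S) [IsProbabilityMeasure μ]

/-- Markov's inequality at order 2q. Since 9q ≤ M, each centered coordinate beyond i only improves
the bound: 9qM ≤ M². -/
theorem measureReal_abs_tupleSum_component_ge_le {r q M n i : ℕ} (hq : 1 ≤ q) (hqM : 9 * q ≤ M)
    (hn : n < M) {L τ : ℝ} (hL : 0 < L) (hτ : 0 < τ) {f : (Fin r → S) → ℝ} (hf : Measurable f)
    (hfL : ∀ x, |f x| ≤ L) {A : Finset (Fin r)} (hA : i ≤ A.card) :
    (iidLaw ℕ μ).real {z | τ ≤ |tupleSum (component μ A f) n z|} ≤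
      ((9 * q * M) ^ i * ((M : ℝ) ^ 2) ^ (r - i) * (2 ^ r * L) ^ 2 / τ ^ 2) ^ q := by
  have hAr : A.card ≤ r := by simpa using A.card_le_univ
  have hfB : IsBddMeasurable f := ⟨hf, L, hfL⟩
  have hcB := hfB.component μ A
  have hM : (0 : ℝ) < M := by exact_mod_cast (Nat.zero_le n).trans_lt hn
  have hqM' : (9 : ℝ) * q ≤ M := by exact_mod_cast hqM
  have hb : ∀ x, |component μ A f x| ≤ 2 ^ r * L := fun x =>
    (abs_component_le μ hfL A x).trans (by gcongr; norm_num)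
  have hmom := integral_tupleSum_pow_le μ (q := q) (M := M) hq (b := 2 ^ r * L) (by positivity)
    hcB.measurable hb (c := fun j => if j ∈ A then (9 * q * M : ℝ) else (M : ℝ) ^ 2) (fun j => by
      by_cases hj : j ∈ A
      · exact Or.inr ⟨by simp [hj], integral_component_update μ hfB hj⟩
      · exact Or.inl (by simp [hj])) hn
  have hprod : (∏ j : Fin r, if j ∈ A then (9 * q * M : ℝ) else (M : ℝ) ^ 2) ≤
      (9 * q * M) ^ i * ((M : ℝ) ^ 2) ^ (r - i) := by
    obtain ⟨k, hk⟩ := Nat.exists_eq_add_of_le hA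
    rw [Finset.prod_ite, Finset.prod_const, Finset.prod_const, Finset.filter_mem_eq_inter,
      Finset.univ_inter, Finset.filter_notMem_eq_sdiff, ← Finset.compl_eq_univ_sdiff,
      Finset.card_compl, Fintype.card_fin, show r - i = k + (r - A.card) by omega, pow_add, hk,
      pow_add, mul_assoc]
    gcongr
    nlinarith
  have hmark := mul_meas_ge_le_integral_of_nonneg (μ := iidLaw ℕ μ)
    (f := fun z => tupleSum (component μ A f) n z ^ (2 * q))
    (ae_of_all _ fun z => by simp only [pow_mul, Pi.zero_apply]; positivity)
    (((hcB.tupleSum n).pow _).integrable _) (τ ^ (2 * q))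
  have hset : {z | τ ≤ |tupleSum (component μ A f) n z|} =
      {z | τ ^ (2 * q) ≤ tupleSum (component μ A f) n z ^ (2 * q)} := by
    ext z
    have e : tupleSum (component μ A f) n z ^ (2 * q) =
        |tupleSum (component μ A f) n z| ^ (2 * q) := by rw [pow_mul, ← sq_abs, ← pow_mul]
    simp only [Set.mem_ofPred_eq]
    rw [e, pow_le_pow_iff_left₀ hτ.le (abs_nonneg _) (by omega)]
  rw [hset, div_pow, le_div_iff₀ (by positivity), mul_comm, ← pow_mul]
  refine (hmark.trans hmom).trans ?_
  have : 0 ≤ ∏ j : Fin r, if j ∈ A then (9 * q * M : ℝ) else (M : ℝ) ^ 2 :=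
    Finset.prod_nonneg fun j _ => by split_ifs <;> positivity
  gcongr

/-- Deviation inequality for the sum over increasing tuples of a kernel that is orthogonal to all
functions of at most `d` coordinates. -/
theorem measureReal_abs_tupleSum_gt_le {r q M n d : ℕ} (hq : 1 ≤ q) (hqM : 9 * q ≤ M)
    (hn : n < M) {L t : ℝ} (hL : 0 < L) (ht : 0 < t) {h : (Fin r → S) → ℝ} (hmeas : Measurable h)
    (hh : Integrable h (iidLaw (Fin r) μ))
    (horth : ∀ B : Finset (Fin r), B.card ≤ d → ∀ ψ : (Fin r → S) → ℝ, IsBddMeasurable ψ →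
      (∀ x z, ψ (B.piecewise x z) = ψ x) → ∫ x, ψ x * h x ∂(iidLaw (Fin r) μ) = 0) :
    (iidLaw ℕ μ).real {z | t < |tupleSum h n z|} ≤
      2 ^ r * ((9 * q * M) ^ (d + 1) * ((M : ℝ) ^ 2) ^ (r - (d + 1)) * (2 ^ r * L) ^ 2 /
        (t / 2 ^ (r + 1)) ^ 2) ^ q +
      (n : ℝ) ^ r * (4 ^ r + 1) * (∫ x, |h x - trunc h L x| ∂(iidLaw (Fin r) μ)) / (t / 2) := by
  set f := trunc h L with hf
  set e := ∫ x, |h x - f x| ∂(iidLaw (Fin r) μ) with he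
  have he0 : 0 ≤ e := integral_nonneg fun _ => abs_nonneg _
  have hfm : Measurable f := measurable_trunc hmeas L
  have hfL : ∀ x, |f x| ≤ L := abs_trunc_le h hL.le
  have hfB : IsBddMeasurable f := ⟨hfm, L, hfL⟩
  have hgi : Integrable (fun x => h x - f x) (iidLaw (Fin r) μ) := hh.sub (hfB.integrable _)
  have hci : ∀ A, Integrable (component μ A f) (iidLaw (Fin r) μ) := fun A =>
    (hfB.component μ A).integrable _
  -- Every B ⊆ A also has at most d coordinates, so each of the at most 2^r marginals has L¹ norm at
  -- most e.
  have hcomp : ∀ A : Finset (Fin r), A.card ≤ d →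
      ∫ x, |component μ A f x| ∂(iidLaw (Fin r) μ) ≤ 2 ^ r * e := by
    intro A hA
    have hAr : A.card ≤ r := by simpa using A.card_le_univ
    have hmi : ∀ B, Integrable (fun x => |marginal μ B f x|) (iidLaw (Fin r) μ) := fun B =>
      ((hfB.marginal μ B).integrable _).abs
    calc ∫ x, |component μ A f x| ∂(iidLaw (Fin r) μ)
        ≤ ∫ x, ∑ B ∈ A.powerset, |marginal μ B f x| ∂(iidLaw (Fin r) μ) := by
          refine integral_mono (hci A).abs (integrable_finsetSum _ fun B _ => hmi B) fun x => ?_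
          refine (Finset.abs_sum_le_sum_abs _ _).trans_eq (Finset.sum_congr rfl fun B _ => ?_)
          rw [abs_mul, abs_mul, abs_pow, abs_pow, abs_neg, abs_one, one_pow, one_pow, one_mul,
            one_mul]
      _ = ∑ B ∈ A.powerset, ∫ x, |marginal μ B f x| ∂(iidLaw (Fin r) μ) :=
          integral_finsetSum _ fun B _ => hmi B
      _ ≤ ∑ B ∈ A.powerset, e := by
          refine Finset.sum_le_sum fun B hB => ?_
          exact integral_abs_marginal_le μ hfB hh fun ψ hψ hpw => horth B
            ((Finset.card_le_card (Finset.mem_powerset.1 hB)).trans hA) ψ hψ hpw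
      _ = 2 ^ A.card * e := by
          rw [Finset.sum_const, Finset.card_powerset, nsmul_eq_mul]; push_cast; rfl
      _ ≤ 2 ^ r * e := by gcongr; norm_num
  set good : Finset (Finset (Fin r)) := Finset.univ.filter fun A => d + 1 ≤ A.card with hgood
  set bad : Finset (Finset (Fin r)) := Finset.univ.filter fun A => ¬ d + 1 ≤ A.card with hbad
  have hcard : ∀ p : Finset (Fin r) → Prop, [DecidablePred p] →
      (((Finset.univ.filter p).card : ℕ) : ℝ) ≤ 2 ^ r := by
    intro p _
    have : (Finset.univ.filter p).card ≤ 2 ^ r :=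
      (Finset.card_filter_le _ _).trans_eq (by simp)
    exact_mod_cast this
  set rest : (ℕ → S) → ℝ := fun z => ∑ A ∈ bad, tupleSum (component μ A f) n z +
    tupleSum (fun x => h x - f x) n z with hrest
  have hdecomp : ∀ z, tupleSum h n z =
      ∑ A ∈ good, tupleSum (component μ A f) n z + rest z := by
    intro z
    have e1 : h = fun x => ∑ A : Finset (Fin r), component μ A f x + (h x - f x) := by
      funext x; rw [sum_component]; ring
    conv_lhs => rw [e1]
    rw [tupleSum_add, tupleSum_sum, hrest, ← add_assoc, Finset.sum_filter_add_sum_filter_not]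
  have hri : Integrable rest (iidLaw ℕ μ) :=
    (integrable_finsetSum _ fun A _ => integrable_tupleSum μ (hci A) n).add
      (integrable_tupleSum μ hgi n)
  have hrint : ∫ z, |rest z| ∂(iidLaw ℕ μ) ≤ (n : ℝ) ^ r * (4 ^ r + 1) * e := by
    calc ∫ z, |rest z| ∂(iidLaw ℕ μ)
        ≤ ∫ z, (∑ A ∈ bad, |tupleSum (component μ A f) n z| +
            |tupleSum (fun x => h x - f x) n z|) ∂(iidLaw ℕ μ) := by
          refine integral_mono hri.abs ((integrable_finsetSum _ fun A _ =>
            (integrable_tupleSum μ (hci A) n).abs).add (integrable_tupleSum μ hgi n).abs)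
            fun z => ?_
          exact (abs_add_le _ _).trans (add_le_add_left (Finset.abs_sum_le_sum_abs _ _) _)
      _ = ∑ A ∈ bad, ∫ z, |tupleSum (component μ A f) n z| ∂(iidLaw ℕ μ) +
            ∫ z, |tupleSum (fun x => h x - f x) n z| ∂(iidLaw ℕ μ) := by
          rw [integral_add (integrable_finsetSum _ fun A _ =>
            (integrable_tupleSum μ (hci A) n).abs) (integrable_tupleSum μ hgi n).abs,
            integral_finsetSum _ fun A _ => (integrable_tupleSum μ (hci A) n).abs]
      _ ≤ ∑ A ∈ bad, (n : ℝ) ^ r * (2 ^ r * e) + (n : ℝ) ^ r * e := by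
          refine add_le_add (Finset.sum_le_sum fun A hA => ?_) (integral_abs_tupleSum_le μ hgi n)
          refine (integral_abs_tupleSum_le μ (hci A) n).trans ?_
          have := hcomp A (by have := (Finset.mem_filter.1 hA).2; omega)
          gcongr
      _ ≤ 2 ^ r * ((n : ℝ) ^ r * (2 ^ r * e)) + (n : ℝ) ^ r * e := by
          rw [Finset.sum_const, nsmul_eq_mul]
          have := hcard fun A => ¬ d + 1 ≤ A.card
          gcongr
      _ = _ := by
          rw [show (4 : ℝ) = 2 * 2 by norm_num, mul_pow]; ring
  -- Half of t goes to the remainder; the other half is shared by at most 2^r large components.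
  have hsub : {z | t < |tupleSum h n z|} ⊆
      (⋃ A ∈ good, {z | t / 2 ^ (r + 1) ≤ |tupleSum (component μ A f) n z|}) ∪
        {z | t / 2 ≤ |rest z|} := by
    intro z hz
    by_contra hcon
    simp only [Set.mem_union, Set.mem_iUnion, Set.mem_ofPred_eq, not_or, not_exists, not_le] at hcon
    have h1 : |∑ A ∈ good, tupleSum (component μ A f) n z| ≤ t / 2 := by
      calc _ ≤ ∑ A ∈ good, |tupleSum (component μ A f) n z| := Finset.abs_sum_le_sum_abs _ _
        _ ≤ ∑ A ∈ good, t / 2 ^ (r + 1) := Finset.sum_le_sum fun A hA => (hcon.1 A hA).le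
        _ ≤ 2 ^ r * (t / 2 ^ (r + 1)) := by
          rw [Finset.sum_const, nsmul_eq_mul]
          have := hcard fun A => d + 1 ≤ A.card
          gcongr
        _ = t / 2 := by rw [pow_succ]; field_simp
    have h2 : t < |tupleSum h n z| := hz
    rw [hdecomp] at h2
    linarith [abs_add_le (∑ A ∈ good, tupleSum (component μ A f) n z) (rest z), hcon.2]
  refine (measureReal_mono hsub).trans ((measureReal_union_le _ _).trans (add_le_add ?_ ?_))
  · refine (measureReal_biUnion_finset_le _ _).trans ?_
    refine (Finset.sum_le_sum fun A hA => measureReal_abs_tupleSum_component_ge_le μ hq hqM hn hL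
      (by positivity) hfm hfL (i := d + 1) (Finset.mem_filter.1 hA).2).trans ?_
    rw [Finset.sum_const, nsmul_eq_mul]
    have := hcard fun A => d + 1 ≤ A.card
    gcongr
  · rw [le_div_iff₀ (by positivity), mul_comm]
    exact (mul_meas_ge_le_integral_of_nonneg (ae_of_all _ fun z => abs_nonneg _) hri.abs _).trans
      hrint

end Deviation

/-! ### Choice of scales, union bound and summation -/

theorem summable_pow_mul_exp_neg_rpow {κ : ℝ} (hκ : 0 < κ) (p : ℕ) :
    Summable fun N : ℕ => ((2 : ℝ) ^ N) ^ p * Real.exp (-((2 : ℝ) ^ N) ^ κ) := by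
  obtain ⟨m, hm⟩ := exists_nat_ge ((p + 1) / κ)
  rw [div_le_iff₀ hκ] at hm
  refine Summable.of_nonneg_of_le (fun N => by positivity) (fun N => ?_)
    ((summable_geometric_of_lt_one (r := (1 / 2 : ℝ)) (by norm_num) (by norm_num)).mul_left
      (m.factorial : ℝ))
  set V : ℝ := (2 : ℝ) ^ N with hV
  have hV1 : 1 ≤ V := one_le_pow₀ (by norm_num)
  have hV0 : 0 < V := by positivity
  have h1 : V ^ (p + 1) ≤ (V ^ κ) ^ m := by
    rw [← Real.rpow_natCast (V ^ κ), ← Real.rpow_mul hV0.le, ← Real.rpow_natCast V]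
    refine Real.rpow_le_rpow_of_exponent_le hV1 ?_
    push_cast; linarith
  have h2 := Real.pow_div_factorial_le_exp _ (Real.rpow_nonneg hV0.le κ) m
  rw [div_le_iff₀ (by positivity)] at h2
  have h3 : (1 / 2 : ℝ) ^ N = 1 / V := by rw [hV, one_div_pow]
  rw [h3, Real.exp_neg, mul_one_div, ← div_eq_mul_inv, div_le_div_iff₀ (Real.exp_pos _) hV0]
  calc V ^ p * V = V ^ (p + 1) := (pow_succ _ _).symm
    _ ≤ _ := (h1.trans h2).trans_eq (mul_comm _ _)

/-- The scales of truncation and of the moment order are balanced. -/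
theorem base_le {V q ε η α κ a : ℝ} {r i : ℕ} (hir : i ≤ r) (hV : 0 < V) (hε : 0 < ε)
    (hq0 : 0 ≤ q) (hq : q ≤ 3 * V ^ κ) (hbal : κ * i + i + 2 * (r - i) + 2 * a = 2 * α) :
    (9 * q * (27 * V)) ^ i * ((27 * V) ^ 2) ^ (r - i) * (2 ^ r * (η * V ^ a)) ^ 2 /
      (ε * V ^ α / 2 ^ (r + 1)) ^ 2 ≤
    729 ^ i * 729 ^ (r - i) * (2 ^ r) ^ 2 * (2 ^ (r + 1)) ^ 2 / ε ^ 2 * η ^ 2 := by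
  have hpow : (V ^ κ) ^ i * V ^ i * (V ^ 2) ^ (r - i) * (V ^ a) ^ 2 = (V ^ α) ^ 2 := by
    simp only [← Real.rpow_natCast, ← Real.rpow_mul hV.le, ← Real.rpow_add hV]
    congr 1
    rw [Nat.cast_sub hir]
    push_cast
    linarith
  have hVα : 0 < V ^ α := Real.rpow_pos_of_pos hV _
  rw [div_le_iff₀ (by positivity)]
  calc _ ≤ (9 * (3 * V ^ κ) * (27 * V)) ^ i * ((27 * V) ^ 2) ^ (r - i) *
        (2 ^ r * (η * V ^ a)) ^ 2 := by gcongr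
    _ = 729 ^ i * 729 ^ (r - i) * (2 ^ r) ^ 2 * η ^ 2 *
        ((V ^ κ) ^ i * V ^ i * (V ^ 2) ^ (r - i) * (V ^ a) ^ 2) := by
      rw [show 9 * (3 * V ^ κ) * (27 * V) = 729 * (V ^ κ * V) by ring,
        show (27 * V) ^ 2 = 729 * V ^ 2 by ring]
      simp only [mul_pow _ _ i, mul_pow _ _ (r - i)]
      ring
    _ = _ := by rw [hpow]; field_simp

theorem setOf_lt_maxAbsUStat_subset {Ω S : Type*} {r : ℕ} (h : (Fin r → S) → ℝ) (X : ℕ → Ω → S)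
    (M : ℕ) {t : ℝ} (ht : 0 ≤ t) :
    {ω | t < maxAbsUStat h X M ω} ⊆ ⋃ n ∈ Finset.Icc r M, {ω | t < |uStat h X n ω|} := by
  intro ω hω
  lift t to NNReal using ht
  have h1 : t < (Finset.Icc r M).sup fun n => ‖uStat h X n ω‖₊ := by exact_mod_cast hω
  obtain ⟨n, hn, h2⟩ := Finset.lt_sup_iff.1 h1
  refine Set.mem_biUnion hn ?_
  have h3 : (t : ℝ) < (‖uStat h X n ω‖₊ : ℝ) := by exact_mod_cast h2
  simpa using h3

/-- Probabilities of events on the sequence of observations are those under the product law. -/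
theorem IsIID.measureReal_abs_uStat_gt {Ω S : Type*} [MeasurableSpace Ω] [MeasurableSpace S]
    {P : Measure Ω} {X : ℕ → Ω → S} [IsProbabilityMeasure (P.map (X 0))] (hX : IsIID X P) {r : ℕ}
    {h : (Fin r → S) → ℝ} (hmeas : Measurable h) (n : ℕ) (t : ℝ) :
    P.real {ω | t < |uStat h X n ω|} =
      (iidLaw ℕ (P.map (X 0))).real {z | t < |tupleSum h n z|} := by
  have hm : Measurable (tupleSum h n) := Finset.measurable_fun_sum _ fun i _ => hmeas.comp
    (measurable_pi_lambda (fun (z : ℕ → S) j => z (i j)) fun j => measurable_pi_apply (i j))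
  rw [← hX.map_eq, map_measureReal_apply (measurable_pi_iff.2 hX.measurable)
    (measurableSet_lt measurable_const hm.abs)]
  rfl

end UStat

theorem mainTheorem4 {Ω S : Type*} [MeasurableSpace Ω] [MeasurableSpace S]
    (P : Measure Ω) [IsProbabilityMeasure P]
    (r i : ℕ) (hr : 2 ≤ r) (hi : 2 ≤ i) (hir : i ≤ r)
    (h : (Fin r → S) → ℝ) (hmeas : Measurable h) (hsymm : UStat.IsSymmetric h)
    (X : ℕ → Ω → S) (hX : UStat.IsIID X P)
    (hdeg : UStat.IsDegenerate h X P (i - 1))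
    (α : ℝ) (hα : α ∈ Set.Ioo ((r : ℝ) - (i : ℝ) / 2) (r : ℝ))
    (γ : ℝ) (hγ : 0 < γ)
    (hexp : ∀ R : ℝ, 0 < R → Integrable (fun ω => Real.exp (R * |UStat.kernelVar h X ω| ^ γ)) P) :
    ∀ ε : ℝ, 0 < ε →
      Summable (fun N : ℕ =>
        Real.exp ((2 : ℝ) ^
            ((N : ℝ) * (α - ((r : ℝ) - (i : ℝ) / 2)) * (2 * γ / ((i : ℝ) * γ + 2)))) *
          P.real {ω | ε * (2 : ℝ) ^ ((N : ℝ) * α) < UStat.maxAbsUStat h X (2 ^ N) ω}) := by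
  intro ε hε
  have hμ : IsProbabilityMeasure (P.map (X 0)) :=
    Measure.isProbabilityMeasure_map (hX.measurable 0).aemeasurable
  set μ := P.map (X 0) with hμdef
  set ρ := UStat.iidLaw (Fin r) μ with hρ
  have hXm : Measurable (fun ω (j : Fin r) => X (j : ℕ) ω) :=
    measurable_pi_iff.2 fun j => hX.measurable j
  have hρmap : P.map (fun ω (j : Fin r) => X (j : ℕ) ω) = ρ := hX.map_initial_eq r
  have hhint : Integrable h ρ := by
    rw [← hρmap]
    exact (integrable_map_measure hmeas.aestronglyMeasurable hXm.aemeasurable).2 hdeg.integrable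
  have hexpρ : ∀ R : ℝ, 0 < R → Integrable (fun x => Real.exp (R * |h x| ^ γ)) ρ := by
    intro R hR
    rw [← hρmap]
    refine (integrable_map_measure ?_ hXm.aemeasurable).2 (hexp R hR)
    exact (((hmeas.abs.pow_const γ).const_mul R).exp).aestronglyMeasurable
  have horth : ∀ B : Finset (Fin r), B.card ≤ i - 1 → ∀ ψ : (Fin r → S) → ℝ,
      UStat.IsBddMeasurable ψ → (∀ x z, ψ (B.piecewise x z) = ψ x) → ∫ x, ψ x * h x ∂ρ = 0 :=
    fun B hB ψ hψ hpw => UStat.integral_mul_eq_zero_of_condExp_eq_zero hX hmeas hsymm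
      hdeg.integrable hdeg.condExp_eq_zero hB hψ hpw
  set δ : ℝ := α - ((r : ℝ) - (i : ℝ) / 2) with hδ
  have hi0 : (2 : ℝ) ≤ i := by exact_mod_cast hi
  have hir0 : (i : ℝ) ≤ r := by exact_mod_cast hir
  have hδ0 : 0 < δ := by rw [hδ]; linarith [hα.1]
  have hδi : δ < i / 2 := by rw [hδ]; linarith [hα.2]
  have hα0 : 0 < α := by linarith [hα.1]
  have hden : 0 < (i : ℝ) * γ + 2 := by positivity
  -- These exponents solve aγ = κ, which matches the truncation tail to the moment order, and κi +
  -- 2a = 2δ, which cancels all powers of V in the moment bound.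
  set κ : ℝ := δ * (2 * γ / ((i : ℝ) * γ + 2)) with hκ
  set a : ℝ := δ * (2 / ((i : ℝ) * γ + 2)) with ha
  have hκ0 : 0 < κ := by positivity
  -- This is where α < r enters, through δ < i/2; it gives V^κ ≤ V, hence 9q ≤ 27V.
  have hκ1 : κ ≤ 1 := by
    rw [hκ, ← mul_div_assoc, div_le_one hden]; nlinarith
  have haγ : a * γ = κ := by rw [ha, hκ]; ring
  have hbal : κ * i + i + 2 * (r - i) + 2 * a = 2 * α := by
    have h1 : κ * i + 2 * a = 2 * δ := by rw [hκ, ha]; field_simp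
    have h2 : 2 * δ = 2 * α - (2 * r - i) := by rw [hδ]; ring
    linarith
  set C₀ : ℝ := 729 ^ i * 729 ^ (r - i) * (2 ^ r) ^ 2 * (2 ^ (r + 1)) ^ 2 / ε ^ 2 with hC₀
  have hC₀pos : 0 < C₀ := by positivity
  -- Makes the base of the q-th power at most 1/e. The rate 2 / η^γ used below turns the truncation
  -- tail at level η V^a into exp(-2 V^κ).
  set η : ℝ := √(Real.exp (-1) / C₀) with hη
  have hη0 : 0 < η := Real.sqrt_pos.2 (by positivity)
  have hηC : C₀ * η ^ 2 = Real.exp (-1) := by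
    rw [hη, Real.sq_sqrt (by positivity)]; field_simp
  have hηγ : 0 < η ^ γ := Real.rpow_pos_of_pos hη0 _
  obtain ⟨C, hC0, hC⟩ := UStat.exists_integral_abs_sub_trunc_le hγ hexpρ
    (R := 2 / η ^ γ) (by positivity)
  set K : ℝ := 2 ^ r + (4 ^ r + 1) * C / (ε / 2) with hK
  have hK0 : 0 ≤ K := by positivity
  have main : ∀ N : ℕ, P.real {ω | ε * (2 : ℝ) ^ ((N : ℝ) * α) < UStat.maxAbsUStat h X (2 ^ N) ω} ≤
      K * (((2 : ℝ) ^ N) ^ (r + 1) * Real.exp (-(2 * ((2 : ℝ) ^ N) ^ κ))) := by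
    intro N
    set V : ℝ := (2 : ℝ) ^ N with hV
    have hV1 : 1 ≤ V := one_le_pow₀ (by norm_num)
    have hV0 : 0 < V := by positivity
    have hVκ1 : 1 ≤ V ^ κ := Real.one_le_rpow hV1 hκ0.le
    have hVκV : V ^ κ ≤ V := by
      simpa using Real.rpow_le_rpow_of_exponent_le hV1 hκ1
    have hVα1 : 1 ≤ V ^ α := Real.one_le_rpow hV1 hα0.le
    have hVN : (2 : ℝ) ^ ((N : ℝ) * α) = V ^ α := by
      rw [Real.rpow_mul (by norm_num), Real.rpow_natCast]
    rw [hVN]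
    -- The factor 2 leaves exp(-V^κ) to spare after the weight exp(V^κ) is paid for.
    set q : ℕ := ⌈2 * V ^ κ⌉₊ with hq
    have hq2 : 2 * V ^ κ ≤ q := Nat.le_ceil _
    have hq3 : (q : ℝ) ≤ 3 * V ^ κ := by
      have := (Nat.ceil_lt_add_one (by positivity : 0 ≤ 2 * V ^ κ)).le
      linarith
    have hq1 : 1 ≤ q := by
      have : (1 : ℝ) ≤ q := by linarith
      exact_mod_cast this
    have hqM : 9 * q ≤ 27 * 2 ^ N := by
      have : (9 : ℝ) * q ≤ 27 * 2 ^ N := by rw [← hV]; linarith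
      exact_mod_cast this
    have hMcast : ((27 * 2 ^ N : ℕ) : ℝ) = 27 * V := by push_cast; rfl
    have hVa : 0 < V ^ a := Real.rpow_pos_of_pos hV0 _
    set L : ℝ := η * V ^ a with hL
    have hL0 : 0 < L := by positivity
    have hLγ : 2 / η ^ γ * L ^ γ = 2 * V ^ κ := by
      rw [hL, Real.mul_rpow hη0.le hVa.le, ← Real.rpow_mul hV0.le, haγ]; field_simp
    have htail := hC L hL0.le
    rw [hLγ] at htail
    have each : ∀ n ∈ Finset.Icc r (2 ^ N), P.real {ω | ε * V ^ α < |UStat.uStat h X n ω|} ≤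
        K * V ^ r * Real.exp (-(2 * V ^ κ)) := by
      intro n hn
      have hn2 := (Finset.mem_Icc.1 hn).2
      have hnV : (n : ℝ) ≤ V := by rw [hV]; exact_mod_cast hn2
      rw [hX.measureReal_abs_uStat_gt hmeas]
      have hpos : 0 < 2 ^ N := by positivity
      refine (UStat.measureReal_abs_tupleSum_gt_le μ hq1 hqM (by omega) hL0 (by positivity) hmeas
        hhint horth).trans ?_
      rw [hMcast, show i - 1 + 1 = i by omega]
      have hb := UStat.base_le (η := η) hir hV0 hε q.cast_nonneg hq3 hbal
      rw [← hC₀, hηC] at hb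
      have hexpq : Real.exp (-1) ^ q ≤ Real.exp (-(2 * V ^ κ)) := by
        rw [← Real.exp_nat_mul]
        exact Real.exp_le_exp.2 (by linarith)
      have hVr : 1 ≤ V ^ r := one_le_pow₀ hV1
      calc _ ≤ 2 ^ r * Real.exp (-1) ^ q +
            V ^ r * (4 ^ r + 1) * (C * Real.exp (-(2 * V ^ κ))) / (ε * 1 / 2) := by gcongr
        _ ≤ 2 ^ r * (V ^ r * Real.exp (-(2 * V ^ κ))) +
            V ^ r * (4 ^ r + 1) * (C * Real.exp (-(2 * V ^ κ))) / (ε * 1 / 2) := by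
          gcongr
          exact hexpq.trans (le_mul_of_one_le_left (Real.exp_pos _).le hVr)
        _ = _ := by rw [hK, mul_one]; ring
    calc _ ≤ P.real (⋃ n ∈ Finset.Icc r (2 ^ N), {ω | ε * V ^ α < |UStat.uStat h X n ω|}) :=
          measureReal_mono (UStat.setOf_lt_maxAbsUStat_subset h X _ (by positivity))
            (measure_ne_top P _)
      _ ≤ ∑ n ∈ Finset.Icc r (2 ^ N), P.real {ω | ε * V ^ α < |UStat.uStat h X n ω|} :=
          measureReal_biUnion_finset_le _ _
      _ ≤ (Finset.Icc r (2 ^ N)).card * (K * V ^ r * Real.exp (-(2 * V ^ κ))) := by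
          rw [← nsmul_eq_mul, ← Finset.sum_const]; exact Finset.sum_le_sum each
      _ ≤ V * (K * V ^ r * Real.exp (-(2 * V ^ κ))) := by
          have : (Finset.Icc r (2 ^ N)).card ≤ 2 ^ N := by rw [Nat.card_Icc]; omega
          have : ((Finset.Icc r (2 ^ N)).card : ℝ) ≤ V := by rw [hV]; exact_mod_cast this
          gcongr
      _ = _ := by ring
  refine Summable.of_nonneg_of_le (fun N => by positivity) (fun N => ?_)
    ((UStat.summable_pow_mul_exp_neg_rpow hκ0 (r + 1)).mul_left K)
  have hexpo : (2 : ℝ) ^ ((N : ℝ) * δ * (2 * γ / ((i : ℝ) * γ + 2))) = ((2 : ℝ) ^ N) ^ κ := by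
    rw [mul_assoc, ← hκ, Real.rpow_mul (by norm_num), Real.rpow_natCast]
  rw [hexpo]
  refine (mul_le_mul_of_nonneg_left (main N) (Real.exp_pos _).le).trans_eq ?_
  rw [show -((2 : ℝ) ^ N) ^ κ = ((2 : ℝ) ^ N) ^ κ + -(2 * ((2 : ℝ) ^ N) ^ κ) by ring, Real.exp_add]
  ring
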